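/- Let $N\ge 1$ and let $T_1,\dots,T_m$ be non-singular linear maps $\mathbb R^N\to\mathbb R^N$ with operator norms $\|T_i\|<1$ for all $i$. Write $I_k$ for the set of words of length $k$ over $\{1,\dots,m\}$, $I=\bigcup_{k\ge 0}I_k$, and $I_\infty=\{1,\dots,m\}^{\mathbb N}$ for the code space of infinite words with the product topology. For $\mathbf i=(i_1,\dots,i_k)\in I$ put $T_{\mathbf i}=T_{i_1}\cdots T_{i_k}$ (the identity for the empty word), and let $C_{\mathbf i}\subset I_\infty$ be the cylinder of all infinite words beginning with $\mathbf i$. For a linear map $T$ with singular values $\alpha_1\ge\dots\ge\alpha_N$, let $\phi^0(T)=1$, let $\phi^s(T)=\alpha_1\cdots\alpha_{j-1}\alpha_j^{\,s-j+1}$ for $0<s\le N$, where $j$ is the integer with $j-1<s\le j$, and let $\phi^s(T)=(\alpha_1\cdots\alpha_N)^{s/N}$ for $s>N$. Let $(\omega_{\mathbf i})_{\mathbf i\in I}$ be independent identically distributed random vectors taking values in a bounded set $D\subset\mathbb R^N$, whose common law is absolutely continuous with respect to Lebesgue measure. For $\mathbf i=(i_1,i_2,\dots)\in I_\infty$ let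 $$\Pi^\omega(\mathbf i)=\omega_{i_1}+T_{i_1}\omega_{i_1,i_2}+T_{i_1}T_{i_2}\omega_{i_1,i_2,i_3}+\cdots .$$ Let $\mu$ be a non-zero finite Borel measure on $I_\infty$ and let $\mu^\omega=\mu\circ(\Pi^\omega)^{-1}$ be its image under $\Pi^\omega$. For a non-zero finite Borel measure $\tau$ of bounded support on $\mathbb R^N$ and $q>1$, the lower generalised $q$-dimension of $\tau$ is $$\underline D_q(\tau)=\liminf_{r\to0^+}\frac{\log\sum_{C}\tau(C)^q}{(q-1)\log r},$$ where the sum is over the cubes $C=\prod_{l=1}^N[j_lr,(j_l+1)r)$ with $j_1,\dots,j_N\in\mathbb Z$. Then, for every $q>1$, almost surely $$\underline D_q(\mu^\omega)=\min\{d_q^-,N\},\qquad\text{where}\qquad d_q^-=\sup\Big\{s\ge0:\ \sum_{k=0}^\infty\sum_{\mathbf i\in I_k}\phi^s(T_{\mathbf i})^{1-q}\mu(C_{\mathbf i})^q<\infty\Big\}$$ and the supremum of the empty set is $0$. -/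

import Mathlib

open MeasureTheory ProbabilityTheory Filter Topology
open scoped ENNReal NNReal

noncomputable section

namespace AlmostSelfAffine

/-- `ℝ^N` with its Euclidean norm. -/
abbrev Esp (N : ℕ) : Type := EuclideanSpace ℝ (Fin N)

/-- The code space of infinite words over `m` letters, with the product topology (the topology of
the metric `2 ^ (-|i ∧ j|)`) and the product σ-algebra, which is its Borel σ-algebra. -/
abbrev CodeSpace (m : ℕ) : Type := ℕ → Fin m

/-- The curtailment `i|ₖ` of an infinite word after `k` terms. -/
def curtail {m : ℕ} (i : CodeSpace m) (k : ℕ) : List (Fin m) :=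
  List.ofFn fun j : Fin k => i j

/-- The cylinder of all infinite words that extend the finite word `w`. -/
def wordCylinder {m : ℕ} (w : List (Fin m)) : Set (CodeSpace m) :=
  {i | curtail i w.length = w}

/-- `T_w = T_{w₁} T_{w₂} ⋯ T_{w_k}`, the identity for the empty word. -/
def wordMap {m N : ℕ} (T : Fin m → Esp N →L[ℝ] Esp N) (w : List (Fin m)) :
    Esp N →L[ℝ] Esp N :=
  (w.map T).prod

/-- The singular value function `φ^s(T)`, `s ≥ 0`. Write `α₁ ≥ … ≥ α_N` for the singular values of
`T`; in Mathlib they are indexed from `0`. For `0 < s ≤ N` and the integer `j` with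
`j - 1 < s ≤ j` the value is `α₁ ⋯ α_{j-1} α_j ^ (s - (j - 1))`. At `s = 0` the truncated
subtraction `⌈0⌉₊ - 1 = 0` gives the exponent `0`, so that `φ^0(T) = 1`. For `s > N` the value is
`(α₁ ⋯ α_N) ^ (s / N)`. -/
def singularValueFunction {N : ℕ} (s : ℝ≥0) (T : Esp N →L[ℝ] Esp N) : ℝ :=
  if (s : ℝ) ≤ N then
    (∏ i ∈ Finset.range (⌈s⌉₊ - 1), T.toLinearMap.singularValues i) *
      T.toLinearMap.singularValues (⌈s⌉₊ - 1) ^ ((s : ℝ) - ((⌈s⌉₊ - 1 : ℕ) : ℝ))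
  else
    (∏ i ∈ Finset.range N, T.toLinearMap.singularValues i) ^ ((s : ℝ) / N)

/-- The series `∑_k ∑_{|i| = k} φ^s(T_i)^(1-q) μ(C_i)^q`. -/
def momentSeries {m N : ℕ} (T : Fin m → Esp N →L[ℝ] Esp N) (μ : Measure (CodeSpace m)) (q : ℝ)
    (s : ℝ≥0) : ℝ≥0∞ :=
  ∑' k : ℕ, ∑ i : Fin k → Fin m,
    ENNReal.ofReal (singularValueFunction s (wordMap T (List.ofFn i))) ^ (1 - q) *
      μ (wordCylinder (List.ofFn i)) ^ q

/-- `d_q^-(T₁, …, T_m; μ)`: the supremum of the `s ≥ 0` for which the series converges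
(`0` if there is no such `s`). -/
def dqLower {m N : ℕ} (T : Fin m → Esp N →L[ℝ] Esp N) (μ : Measure (CodeSpace m)) (q : ℝ) :
    ℝ≥0∞ :=
  ⨆ (s : ℝ≥0) (_ : momentSeries T μ q s < ∞), (s : ℝ≥0∞)

/-- The projection `Π^ω(i) = ω_{i₁} + T_{i₁} ω_{i₁,i₂} + T_{i₁} T_{i₂} ω_{i₁,i₂,i₃} + ⋯`
for a family `ω` of displacements indexed by the finite words. -/
def proj {m N : ℕ} (T : Fin m → Esp N →L[ℝ] Esp N) (ω : List (Fin m) → Esp N)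
    (i : CodeSpace m) : Esp N :=
  ∑' k : ℕ, wordMap T (curtail i k) (ω (curtail i (k + 1)))

/-- The image `μ^ω` of `μ` under `Π^ω`. -/
def projMeasure {m N : ℕ} (T : Fin m → Esp N →L[ℝ] Esp N) (μ : Measure (CodeSpace m))
    (ω : List (Fin m) → Esp N) : Measure (Esp N) :=
  μ.map (proj T ω)

/-- The `r`-mesh cube `[j₁ r, (j₁ + 1) r) × ⋯ × [j_N r, (j_N + 1) r)`. -/
def meshCube {N : ℕ} (r : ℝ) (j : Fin N → ℤ) : Set (Esp N) :=
  {x | ∀ l, x l ∈ Set.Ico ((j l : ℝ) * r) (((j l : ℝ) + 1) * r)}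

/-- The moment sum `M_r(q) = ∑_C τ(C)^q` over the `r`-mesh cubes. For `q > 0` the cubes of measure
zero contribute nothing. -/
def momentSum {N : ℕ} (τ : Measure (Esp N)) (q r : ℝ) : ℝ≥0∞ :=
  ∑' j : Fin N → ℤ, τ (meshCube r j) ^ q

/-- The lower generalised `q`-dimension `liminf_{r → 0+} log M_r(q) / ((q - 1) log r)`. -/
def lowerDim {N : ℕ} (τ : Measure (Esp N)) (q : ℝ) : EReal :=
  liminf (fun r : ℝ => ENNReal.log (momentSum τ q r) / (((q - 1) * Real.log r : ℝ) : EReal))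
    (𝓝[>] (0 : ℝ))

end AlmostSelfAffine

end

noncomputable section

namespace AlmostSelfAffine

/-! ### Singular values -/

/-! The upper bound holds for every bounded choice of displacements; only the lower bound uses
randomness.

Upper bound. The image of the cylinder of a word `w` lies in a translate of the `T_w`-image of a
ball. If `r` is comparable with the singular value of `T_w` on which `φ^s` has its fractional
exponent, about `φ^s(T_w) r^(-s)` mesh cubes cover this ellipsoid. Hölder's inequality then bounds
`φ^s(T_w)^(1-q) μ(C_w)^q` by `r^(-s(q-1))` times the contribution of `C_w` to the moment sum at
scale `r`. Cylinders of words of equal length are disjoint, so their contributions add up to at most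
the whole moment sum. If that is `O(r^(t(q-1)))` with `t > s`, summing over dyadic scales and word
lengths gives two geometric series (`momentSeries_lt_top`). The bound by `N` comes from covering a
bounded set.

Lower bound. The points `Π^ω(j)` have uniformly bounded densities (`exists_density_bound`), although
the density of a single displacement may be unbounded. Hence, whatever the displacements along `w`,
the part of the point beyond `w` lands in a given `r`-cube with probability at most `p = c r^s /
φ^s(T_w)` (`exists_hit_bound`). Fix a cube and let `Y_a` be the mass in it coming from the
subcylinder of `w a`. For `a ≠ b` the displacements below `w b` are independent of `Y_a`, so
`E[Y_a^q Y_b] ≤ p μ(C_(wb)) E[Y_a^q]`.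

The elementary inequality `exists_sum_rpow_le`, valid for every `q > 1`, bounds `(∑ Y_a)^q` by `(1 +
δ) ∑ Y_a^q`, a small multiple of the cross terms `Y_a^q Y_b / z`, and a term linear in `Y`. With `z
= p μ(C_w)` the cross terms are absorbed in expectation, and the linear term, summed over cubes, is
a constant times `r^(s(q-1)) φ^s(T_w)^(1-q) μ(C_w)^q`. This is the recursion
`exists_expectedMoment_le_sum`. Its factor, arbitrarily close to `1`, is iterated down the tree; the
resulting exponential growth is paid for by passing from `s` to a larger exponent `t` at which the
moment series converges. So the expected moment sum is `O(r^(s(q-1)))`, and summing over dyadic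
scales makes the bound almost sure. -/

/-- The exponent of the `i`-th singular value in `φ^s`. -/
def svWeight (N : ℕ) (s : ℝ) (i : ℕ) : ℝ :=
  if s ≤ N then max 0 (min 1 (s - i)) else s / N

/-- The basis diagonalises `T* T`, whose eigenvalues are the squared singular values. Volumes and
covering numbers of ellipsoids are both computed in these coordinates. -/
theorem exists_basis_norm_sq {N : ℕ} (T : Esp N →L[ℝ] Esp N) :
    ∃ b : OrthonormalBasis (Fin N) ℝ (Esp N), ∀ z,
      ‖T z‖ ^ 2 = ∑ i : Fin N, T.toLinearMap.singularValues i ^ 2 * (b.repr z i) ^ 2 := by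
  have hn : Module.finrank ℝ (Esp N) = N := by simp
  set S := T.toLinearMap with hS
  have hsym := S.isSymmetric_adjoint_comp_self
  refine ⟨hsym.eigenvectorBasis hn, fun z => ?_⟩
  set b := hsym.eigenvectorBasis hn with hb
  have h1 : ‖T z‖ ^ 2 = inner ℝ z ((LinearMap.adjoint S ∘ₗ S) z) := by
    rw [LinearMap.comp_apply, LinearMap.adjoint_inner_right, real_inner_self_eq_norm_sq]
    rfl
  rw [h1, ← b.repr.inner_map_map, PiLp.inner_apply]
  refine Finset.sum_congr rfl fun i _ => ?_
  rw [hsym.eigenvectorBasis_apply_self_apply hn z i, S.sq_singularValues_fin hn i]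
  simp [hb]
  ring

theorem singularValues_le_norm {N : ℕ} (T : Esp N →L[ℝ] Esp N) (i : ℕ) :
    T.toLinearMap.singularValues i ≤ ‖T‖ := by
  by_cases hi : i < N
  · obtain ⟨b, hb⟩ := exists_basis_norm_sq T
    have h := hb (b ⟨i, hi⟩)
    have h2 : ‖T (b ⟨i, hi⟩)‖ ≤ ‖T‖ := by simpa using T.le_opNorm (b ⟨i, hi⟩)
    have h3 : T.toLinearMap.singularValues i ^ 2 = ‖T (b ⟨i, hi⟩)‖ ^ 2 := by
      rw [h, Finset.sum_eq_single ⟨i, hi⟩]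
      · simp
      · intro j _ hj
        simp [hj]
      · simp
    rw [sq_eq_sq₀ (LinearMap.singularValues_nonneg _ _) (norm_nonneg _)] at h3
    exact h3 ▸ h2
  · rw [LinearMap.singularValues_of_finrank_le _ (by simpa using hi)]
    exact norm_nonneg _

theorem singularValues_pos {N : ℕ} {T : Esp N →L[ℝ] Esp N} (hT : Function.Injective T) {i : ℕ}
    (hi : i < N) : 0 < T.toLinearMap.singularValues i :=
  (T.toLinearMap.injective_iff_forall_lt_finrank_singularValues_pos.1 hT) i (by simpa using hi)

/-- The index `⌈s⌉₊ - 1` carries the fractional weight. At `s = 0` truncated subtraction makes it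
`0`, with weight `0`; `0 < N` keeps that index in range. -/
theorem exists_svWeight_eq {N : ℕ} (hN : 0 < N) {s : ℝ≥0} (hs : (s : ℝ) ≤ N) :
    ∃ k, N = ⌈s⌉₊ - 1 + 1 + k ∧ ((⌈s⌉₊ - 1 : ℕ) : ℝ) ≤ s ∧ (s : ℝ) ≤ ((⌈s⌉₊ - 1 : ℕ) : ℝ) + 1 ∧
      (∀ i < ⌈s⌉₊ - 1, svWeight N s i = 1) ∧
      svWeight N s (⌈s⌉₊ - 1) = s - ((⌈s⌉₊ - 1 : ℕ) : ℝ) ∧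
      ∀ i, ⌈s⌉₊ - 1 < i → svWeight N s i = 0 := by
  set n := ⌈s⌉₊ - 1 with hn
  have hceil : ⌈s⌉₊ ≤ N := Nat.ceil_le.2 (by exact_mod_cast hs)
  have h1 : (s : ℝ) ≤ (n : ℝ) + 1 := by
    have h2 : (s : ℝ) ≤ (⌈s⌉₊ : ℝ) := by exact_mod_cast Nat.le_ceil s
    have h3 : (⌈s⌉₊ : ℝ) ≤ (n : ℝ) + 1 := by
      have : ⌈s⌉₊ ≤ n + 1 := by omega
      exact_mod_cast this
    linarith
  have h0 : (n : ℝ) ≤ s := by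
    rcases Nat.eq_zero_or_pos n with h | h
    · rw [h]; simp
    · have : n < ⌈s⌉₊ := by omega
      have := Nat.lt_ceil.1 this
      exact_mod_cast this.le
  refine ⟨N - (n + 1), by omega, h0, h1, fun i hi => ?_, ?_, fun i hi => ?_⟩
  · have : (i : ℝ) + 1 ≤ n := by exact_mod_cast hi
    rw [svWeight, if_pos hs, min_eq_left (by linarith), max_eq_right zero_le_one]
  · rw [svWeight, if_pos hs, min_eq_right (by linarith), max_eq_right (by linarith)]
  · have : (n : ℝ) + 1 ≤ i := by exact_mod_cast hi
    rw [svWeight, if_pos hs, min_eq_right (by linarith), max_eq_left (by linarith)]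

theorem singularValueFunction_eq_prod {N : ℕ} (hN : 0 < N) (s : ℝ≥0) (T : Esp N →L[ℝ] Esp N) :
    singularValueFunction s T =
      ∏ i ∈ Finset.range N, T.toLinearMap.singularValues i ^ svWeight N s i := by
  rw [singularValueFunction]
  split_ifs with hs
  · obtain ⟨k, hk, -, -, h1, h2, h3⟩ := exists_svWeight_eq hN hs
    conv_rhs => rw [show Finset.range N = Finset.range (⌈s⌉₊ - 1 + 1 + k) by rw [← hk]]
    rw [Finset.prod_range_add, Finset.prod_range_succ, h2]
    rw [Finset.prod_congr rfl (fun i hi => by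
      rw [h1 i (Finset.mem_range.1 hi), Real.rpow_one] :
      ∀ i ∈ Finset.range (⌈s⌉₊ - 1), T.toLinearMap.singularValues i ^ svWeight N s i =
        T.toLinearMap.singularValues i)]
    rw [Finset.prod_eq_one (s := Finset.range k) (fun i _ => by
      rw [h3 _ (by omega), Real.rpow_zero]), mul_one]
  · rw [← Real.finsetProd_rpow _ _ fun i _ => LinearMap.singularValues_nonneg _ _]
    refine Finset.prod_congr rfl fun i _ => ?_
    rw [svWeight, if_neg hs]

theorem sum_svWeight {N : ℕ} (hN : 0 < N) (s : ℝ≥0) :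
    ∑ i ∈ Finset.range N, svWeight N s i = s := by
  by_cases hs : (s : ℝ) ≤ N
  · obtain ⟨k, hk, -, -, h1, h2, h3⟩ := exists_svWeight_eq hN hs
    rw [show Finset.range N = Finset.range (⌈s⌉₊ - 1 + 1 + k) by rw [← hk]]
    rw [Finset.sum_range_add, Finset.sum_range_succ, h2]
    rw [Finset.sum_congr rfl (fun i hi => h1 i (Finset.mem_range.1 hi) :
      ∀ i ∈ Finset.range (⌈s⌉₊ - 1), svWeight N s i = 1)]
    rw [Finset.sum_eq_zero (s := Finset.range k) (fun i _ => h3 _ (by omega))]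
    simp
  · simp only [svWeight, if_neg hs, Finset.sum_const, Finset.card_range, nsmul_eq_mul]
    have : (N : ℝ) ≠ 0 := by positivity
    field_simp

theorem svWeight_nonneg (N : ℕ) (s : ℝ≥0) (i : ℕ) : 0 ≤ svWeight N s i := by
  rw [svWeight]
  split_ifs
  · exact le_max_left _ _
  · positivity

theorem svWeight_le_one {N : ℕ} {s : ℝ} (hs : s ≤ N) (i : ℕ) : svWeight N s i ≤ 1 := by
  rw [svWeight, if_pos hs]
  exact max_le zero_le_one (min_le_left _ _)

theorem svWeight_mono {N : ℕ} (hN : 0 < N) {s t : ℝ} (hs : s ≤ N) (hst : s ≤ t) (i : ℕ) :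
    svWeight N s i ≤ svWeight N t i := by
  by_cases ht : t ≤ N
  · rw [svWeight, svWeight, if_pos hs, if_pos ht]
    gcongr
  · refine (svWeight_le_one hs i).trans ?_
    rw [svWeight, if_neg ht, le_div_iff₀ (by positivity)]
    linarith

theorem singularValueFunction_pos {N : ℕ} (hN : 0 < N) (s : ℝ≥0) {T : Esp N →L[ℝ] Esp N}
    (hT : Function.Injective T) : 0 < singularValueFunction s T := by
  rw [singularValueFunction_eq_prod hN]
  exact Finset.prod_pos fun i hi =>
    Real.rpow_pos_of_pos (singularValues_pos hT (Finset.mem_range.1 hi)) _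

/-- Passing from `s` to `t` raises every weight, and the increments add up to `t - s`; each singular
value is at most `‖T‖`. For `t > N` every weight is `t / N ≥ 1`, so monotonicity persists. -/
theorem singularValueFunction_le_mul {N : ℕ} (hN : 0 < N) {s t : ℝ≥0} (hs : (s : ℝ) ≤ N)
    (hst : s ≤ t) {T : Esp N →L[ℝ] Esp N} (hT : Function.Injective T) :
    singularValueFunction t T ≤ singularValueFunction s T * ‖T‖ ^ ((t : ℝ) - s) := by
  have hnorm : 0 < ‖T‖ := (singularValues_pos hT hN).trans_le (singularValues_le_norm T 0)
  have h : ‖T‖ ^ ((t : ℝ) - s) =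
      ∏ i ∈ Finset.range N, ‖T‖ ^ (svWeight N t i - svWeight N s i) := by
    rw [← Real.rpow_sum_of_pos hnorm, Finset.sum_sub_distrib, sum_svWeight hN, sum_svWeight hN]
  rw [singularValueFunction_eq_prod hN, singularValueFunction_eq_prod hN, h,
    ← Finset.prod_mul_distrib]
  refine Finset.prod_le_prod (fun i _ => Real.rpow_nonneg (LinearMap.singularValues_nonneg _ _) _)
    fun i hi => ?_
  have hpos := singularValues_pos hT (Finset.mem_range.1 hi)
  calc _ = T.toLinearMap.singularValues i ^ svWeight N s i *
        T.toLinearMap.singularValues i ^ (svWeight N t i - svWeight N s i) := by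
        rw [← Real.rpow_add hpos]; congr 1; ring
    _ ≤ _ := by
        gcongr
        · exact sub_nonneg.2 (svWeight_mono hN hs (by exact_mod_cast hst) i)
        · exact singularValues_le_norm T i

theorem singularValueFunction_zero {N : ℕ} (T : Esp N →L[ℝ] Esp N) :
    singularValueFunction 0 T = 1 := by
  simp [singularValueFunction]

theorem singularValueFunction_le_norm_rpow {N : ℕ} (hN : 0 < N) (s : ℝ≥0) {T : Esp N →L[ℝ] Esp N}
    (hT : Function.Injective T) : singularValueFunction s T ≤ ‖T‖ ^ (s : ℝ) := by
  have := singularValueFunction_le_mul hN (s := 0) (t := s) (by simp) zero_le hT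
  simpa [singularValueFunction_zero] using this

/-- For each weight `w ∈ [0, 1]` one has `min 1 x ≤ x ^ w`, and the weights sum to `s`. This is
where `s ≤ N` enters the probability estimate. -/
theorem prod_min_le {N : ℕ} (hN : 0 < N) {s : ℝ≥0} (hs : (s : ℝ) ≤ N) {T : Esp N →L[ℝ] Esp N}
    (hT : Function.Injective T) {r : ℝ} (hr : 0 < r) :
    ∏ i ∈ Finset.range N, min 1 (r / T.toLinearMap.singularValues i) ≤
      r ^ (s : ℝ) / singularValueFunction s T := by
  have h : r ^ (s : ℝ) = ∏ i ∈ Finset.range N, r ^ svWeight N s i := by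
    rw [← Real.rpow_sum_of_pos hr, sum_svWeight hN]
  rw [singularValueFunction_eq_prod hN, h, ← Finset.prod_div_distrib]
  have hpos : ∀ i ∈ Finset.range N, 0 < T.toLinearMap.singularValues i := fun i hi =>
    singularValues_pos hT (Finset.mem_range.1 hi)
  refine Finset.prod_le_prod (fun i hi => le_min zero_le_one (div_pos hr (hpos i hi)).le)
    fun i hi => ?_
  rw [← Real.div_rpow hr.le (hpos i hi).le]
  have hx : 0 < r / T.toLinearMap.singularValues i := div_pos hr (hpos i hi)
  rcases le_total 1 (r / T.toLinearMap.singularValues i) with h1 | h1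
  · rw [min_eq_left h1]
    exact Real.one_le_rpow h1 (svWeight_nonneg N s i)
  · rw [min_eq_right h1]
    exact Real.self_le_rpow_of_le_one hx.le h1 (svWeight_le_one hs i)

/-- At a scale `r` comparable with the singular value `α_j`, `j - 1 < s ≤ j`, the product
`∏ max 1 (α_i / r)` is comparable with `r ^ (-s) φ^s`. -/
theorem prod_max_le {N : ℕ} (hN : 0 < N) {s : ℝ≥0} (hs : (s : ℝ) ≤ N) {T : Esp N →L[ℝ] Esp N}
    (hT : Function.Injective T) {r : ℝ} (hr : 0 < r)
    (h1 : T.toLinearMap.singularValues (⌈s⌉₊ - 1) ≤ r)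
    (h2 : r ≤ 2 * T.toLinearMap.singularValues (⌈s⌉₊ - 1)) :
    ∏ i ∈ Finset.range N, max 1 (T.toLinearMap.singularValues i / r) ≤
      2 ^ N * (singularValueFunction s T / r ^ (s : ℝ)) := by
  have h : r ^ (s : ℝ) = ∏ i ∈ Finset.range N, r ^ svWeight N s i := by
    rw [← Real.rpow_sum_of_pos hr, sum_svWeight hN]
  obtain ⟨k, hk, -, -, hw1, hw2, hw3⟩ := exists_svWeight_eq hN hs
  rw [singularValueFunction_eq_prod hN, h, ← Finset.prod_div_distrib]
  have h2N : (2 : ℝ) ^ N = ∏ i ∈ Finset.range N, 2 := by simp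
  rw [h2N, ← Finset.prod_mul_distrib]
  refine Finset.prod_le_prod (fun i hi => le_max_of_le_left zero_le_one) fun i hi => ?_
  have hpos : 0 < T.toLinearMap.singularValues i := singularValues_pos hT (Finset.mem_range.1 hi)
  rw [← Real.div_rpow hpos.le hr.le]
  have hx : 0 < T.toLinearMap.singularValues i / r := div_pos hpos hr
  rcases lt_trichotomy i (⌈s⌉₊ - 1) with h | h | h
  · rw [hw1 i h, Real.rpow_one]
    have : T.toLinearMap.singularValues (⌈s⌉₊ - 1) ≤ T.toLinearMap.singularValues i :=
      T.toLinearMap.singularValues_antitone h.le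
    refine max_le ?_ (by linarith)
    rw [← mul_div_assoc, le_div_iff₀ hr]
    linarith
  · have hle : T.toLinearMap.singularValues i / r ≤ 1 := by
      rw [div_le_one hr, h]; exact h1
    rw [max_eq_left hle]
    have h3 := Real.self_le_rpow_of_le_one hx.le hle (svWeight_le_one hs i)
    have h4 : 1 ≤ 2 * (T.toLinearMap.singularValues i / r) := by
      rw [← mul_div_assoc, le_div_iff₀ hr, h]; linarith
    linarith
  · rw [hw3 i h, Real.rpow_zero, max_eq_left]
    · norm_num
    · rw [div_le_one hr]
      exact (T.toLinearMap.singularValues_antitone h.le).trans h1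

/-! ### Volumes and coverings of ellipsoids -/

/-- A bounded set whose image under `T` has small diameter has small volume. -/
theorem volume_le_of_norm_image_le {N : ℕ} (hN : 0 < N) {s : ℝ≥0} (hs : (s : ℝ) ≤ N)
    {T : Esp N →L[ℝ] Esp N} (hT : Function.Injective T) {R r : ℝ} (hR : 1 ≤ R) (hr : 0 < r)
    {A : Set (Esp N)} (hA : ∀ z ∈ A, ‖z‖ ≤ R) (hA' : ∀ z ∈ A, ∀ z' ∈ A, ‖T (z - z')‖ ≤ r) :
    volume A ≤ ENNReal.ofReal ((4 * R) ^ N * (r ^ (s : ℝ) / singularValueFunction s T)) := by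
  rcases A.eq_empty_or_nonempty with rfl | ⟨c, hc⟩
  · simp
  obtain ⟨b, hb⟩ := exists_basis_norm_sq T
  set α : ℕ → ℝ := fun i => T.toLinearMap.singularValues i with hα
  have hpos : ∀ i : Fin N, 0 < α i := fun i => singularValues_pos hT i.2
  -- A coordinate of a difference of points of `A` is at most `2R` in absolute value, and at most `r
  -- / α i` because `‖T z‖ ≥ α i |z i|`. As `R ≥ 1`, `w i` dominates the smaller of the two.
  set w : Fin N → ℝ := fun i => 2 * R * min 1 (r / α i) with hw
  set Box : Set (Fin N → ℝ) :=
    Set.pi Set.univ fun i => Set.Icc (b.repr c i - w i) (b.repr c i + w i) with hBox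
  have hsub : A ⊆ b.repr ⁻¹' (WithLp.ofLp ⁻¹' Box) := by
    intro z hz
    simp only [hBox, Set.mem_preimage, Set.mem_pi, Set.mem_univ, true_implies]
    intro i
    have h1 : |b.repr (z - c) i| ≤ 2 * R := by
      calc |b.repr (z - c) i| ≤ ‖b.repr (z - c)‖ := by
            simpa using PiLp.norm_apply_le (b.repr (z - c)) i
        _ = ‖z - c‖ := b.repr.norm_map _
        _ ≤ ‖z‖ + ‖c‖ := norm_sub_le _ _
        _ ≤ 2 * R := by linarith [hA z hz, hA c hc]
    have h2 : |b.repr (z - c) i| ≤ r / α i := by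
      rw [le_div_iff₀ (hpos i)]
      refine le_trans ?_ (hA' z hz c hc)
      refine abs_le_of_sq_le_sq' ?_ (norm_nonneg _) |>.2
      rw [hb, mul_pow, sq_abs, mul_comm]
      exact Finset.single_le_sum (f := fun i : Fin N =>
        T.toLinearMap.singularValues i ^ 2 * (b.repr (z - c) i) ^ 2)
        (fun i _ => by positivity) (Finset.mem_univ i)
    have h3 : |b.repr (z - c) i| ≤ w i := by
      rw [hw]
      simp only
      rcases le_total 1 (r / α i) with h | h
      · rw [min_eq_left h]; linarith
      · rw [min_eq_right h]
        have : 0 < r / α i := div_pos hr (hpos i)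
        nlinarith
    have h4 := abs_le.1 h3
    simp only [map_sub, PiLp.sub_apply] at h4
    constructor <;> linarith [h4.1, h4.2]
  have hBoxm : MeasurableSet Box := MeasurableSet.univ_pi fun i => measurableSet_Icc
  calc volume A ≤ volume (b.repr ⁻¹' (WithLp.ofLp ⁻¹' Box)) := measure_mono hsub
    _ = volume (WithLp.ofLp ⁻¹' Box : Set (Esp N)) :=
        b.measurePreserving_repr.measure_preimage
          ((PiLp.volume_preserving_ofLp (Fin N)).measurable hBoxm).nullMeasurableSet
    _ = volume Box :=
        (PiLp.volume_preserving_ofLp (Fin N)).measure_preimage hBoxm.nullMeasurableSet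
    _ = ∏ i, ENNReal.ofReal (2 * w i) := by
        rw [hBox, volume_pi_pi]
        refine Finset.prod_congr rfl fun i _ => ?_
        rw [Real.volume_Icc]; congr 1; ring
    _ = ENNReal.ofReal (∏ i : Fin N, 4 * R * min 1 (r / α i)) := by
        rw [ENNReal.ofReal_prod_of_nonneg]
        · refine Finset.prod_congr rfl fun i _ => ?_
          rw [hw]; congr 1; simp only; ring
        · intro i _
          have : 0 < r / α i := div_pos hr (hpos i)
          positivity
    _ ≤ _ := by
        refine ENNReal.ofReal_le_ofReal ?_
        rw [Finset.prod_mul_distrib, Finset.prod_const, Finset.card_univ, Fintype.card_fin]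
        gcongr
        rw [Fin.prod_univ_eq_prod_range (fun i => min 1 (r / α i)) N]
        exact prod_min_le hN hs hT hr

/-! ### Mesh cubes -/

theorem mem_meshCube_iff {N : ℕ} {r : ℝ} (hr : 0 < r) {j : Fin N → ℤ} {x : Esp N} :
    x ∈ meshCube r j ↔ (fun l => ⌊x l / r⌋) = j := by
  simp only [meshCube, Set.mem_ofPred_eq, Set.mem_Ico, funext_iff, Int.floor_eq_iff]
  refine forall_congr' fun l => ?_
  rw [le_div_iff₀ hr, div_lt_iff₀ hr]

theorem measurableSet_meshCube {N : ℕ} (r : ℝ) (j : Fin N → ℤ) :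
    MeasurableSet (meshCube r j : Set (Esp N)) := by
  have : (meshCube r j : Set (Esp N)) =
      ⋂ l, (fun x : Esp N => x l) ⁻¹' Set.Ico ((j l : ℝ) * r) (((j l : ℝ) + 1) * r) := by
    ext x; simp [meshCube]
  rw [this]
  exact MeasurableSet.iInter fun l => measurableSet_Ico.preimage (by fun_prop)

theorem pairwise_disjoint_meshCube {N : ℕ} {r : ℝ} (hr : 0 < r) :
    Pairwise (Function.onFun Disjoint fun j : Fin N → ℤ => (meshCube r j : Set (Esp N))) := by
  intro i j hij
  refine Set.disjoint_left.2 fun x hx hx' => hij ?_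
  rw [mem_meshCube_iff hr] at hx hx'
  exact hx.symm.trans hx'

theorem iUnion_meshCube {N : ℕ} {r : ℝ} (hr : 0 < r) :
    ⋃ j : Fin N → ℤ, (meshCube r j : Set (Esp N)) = Set.univ :=
  Set.eq_univ_of_forall fun x =>
    Set.mem_iUnion.2 ⟨fun l => ⌊x l / r⌋, (mem_meshCube_iff hr).2 rfl⟩

theorem tsum_measure_meshCube {N : ℕ} (τ : Measure (Esp N)) {r : ℝ} (hr : 0 < r) :
    ∑' j : Fin N → ℤ, τ (meshCube r j) = τ Set.univ := by
  rw [← iUnion_meshCube hr, measure_iUnion (pairwise_disjoint_meshCube hr)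
    (measurableSet_meshCube r)]

theorem tsum_measure_meshCube_inter {N : ℕ} (τ : Measure (Esp N)) {r : ℝ} (hr : 0 < r)
    (A : Set (Esp N)) : ∑' j : Fin N → ℤ, τ (meshCube r j ∩ A) = τ A := by
  have := tsum_measure_meshCube (τ.restrict A) hr
  simpa [Measure.restrict_apply (measurableSet_meshCube r _)] using this

/-- Write `x ^ q = x * x ^ (q - 1)` and bound the second factor by the power of the whole sum. -/
theorem tsum_rpow_le_rpow_tsum {ι : Type*} (f : ι → ℝ≥0∞) {q : ℝ} (hq : 1 ≤ q) :
    ∑' i, f i ^ q ≤ (∑' i, f i) ^ q := by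
  have h : ∀ x : ℝ≥0∞, x ^ q = x * x ^ (q - 1) := fun x => by
    conv_rhs => rw [← ENNReal.rpow_one x]
    rw [← ENNReal.rpow_mul, ← ENNReal.rpow_add_of_nonneg _ _ zero_le_one (by linarith)]
    simp
  calc ∑' i, f i ^ q ≤ ∑' i, f i * (∑' i, f i) ^ (q - 1) := by
        refine ENNReal.tsum_le_tsum fun i => ?_
        rw [h]
        gcongr
        exact ENNReal.le_tsum i
    _ = _ := by rw [ENNReal.tsum_mul_right, ← h]

theorem momentSum_le_rpow {N : ℕ} (τ : Measure (Esp N)) {q : ℝ} (hq : 1 ≤ q) {r : ℝ} (hr : 0 < r) :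
    momentSum τ q r ≤ τ Set.univ ^ q := by
  rw [← tsum_measure_meshCube τ hr]
  exact tsum_rpow_le_rpow_tsum _ hq

/-- Hölder's inequality for a set covered by finitely many sets. -/
theorem measure_rpow_le_of_subset_biUnion {X ι : Type*} [MeasurableSpace X] (τ : Measure X) {q : ℝ}
    (hq : 1 ≤ q) (F : Finset ι) (C : ι → Set X) {A : Set X} (hA : A ⊆ ⋃ i ∈ F, C i) :
    τ A ^ q ≤ (F.card : ℝ≥0∞) ^ (q - 1) * ∑ i ∈ F, τ (C i ∩ A) ^ q := by
  refine le_trans ?_ (ENNReal.rpow_sum_le_const_mul_sum_rpow F _ hq)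
  gcongr
  calc τ A ≤ τ (⋃ i ∈ F, C i ∩ A) := measure_mono fun x hx => by
        have := hA hx
        simp only [Set.mem_iUnion, exists_prop] at this
        obtain ⟨i, hi, hx'⟩ := this
        simp only [Set.mem_iUnion, exists_prop]
        exact ⟨i, hi, hx', hx⟩
    _ ≤ _ := measure_biUnion_finset_le _ _

/-- Moment sums at comparable scales are comparable. -/
theorem momentSum_le_momentSum {N : ℕ} (τ : Measure (Esp N)) {q : ℝ} (hq : 1 ≤ q) {r r' : ℝ}
    (hr : 0 < r) (hrr' : r ≤ r') :
    momentSum τ q r ≤ ((2 : ℝ≥0∞) ^ N) ^ (q - 1) * momentSum τ q r' := by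
  have hr' : 0 < r' := hr.trans_le hrr'
  calc momentSum τ q r
      ≤ ∑' j : Fin N → ℤ, ((2 : ℝ≥0∞) ^ N) ^ (q - 1) *
          ∑' j' : Fin N → ℤ, τ (meshCube r' j' ∩ meshCube r j) ^ q := by
        refine ENNReal.tsum_le_tsum fun j => ?_
        -- An interval of length `r ≤ r'` meets at most two consecutive mesh intervals of length
        -- `r'`.
        set F : Finset (Fin N → ℤ) :=
          Fintype.piFinset fun l => {⌊j l * r / r'⌋, ⌊j l * r / r'⌋ + 1} with hF
        have hcard : F.card = 2 ^ N := by
          rw [hF, Fintype.card_piFinset]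
          simp
        have hcov : (meshCube r j : Set (Esp N)) ⊆ ⋃ j' ∈ F, meshCube r' j' := by
          intro x hx
          simp only [Set.mem_iUnion, exists_prop]
          refine ⟨fun l => ⌊x l / r'⌋, ?_, (mem_meshCube_iff hr').2 rfl⟩
          rw [hF, Fintype.mem_piFinset]
          intro l
          obtain ⟨h1, h2⟩ := hx l
          have h3 : ⌊j l * r / r'⌋ ≤ ⌊x l / r'⌋ := by gcongr
          have h4 : ⌊x l / r'⌋ ≤ ⌊j l * r / r'⌋ + 1 := by
            rw [← Int.floor_add_one]
            refine Int.floor_le_floor ?_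
            rw [div_add_one hr'.ne']
            gcongr
            linarith
          simp only [Finset.mem_insert, Finset.mem_singleton]
          omega
        refine (measure_rpow_le_of_subset_biUnion τ hq F _ hcov).trans ?_
        rw [hcard]
        push_cast
        gcongr
        exact ENNReal.sum_le_tsum F
    _ = ((2 : ℝ≥0∞) ^ N) ^ (q - 1) * ∑' j' : Fin N → ℤ, ∑' j : Fin N → ℤ,
          τ (meshCube r j ∩ meshCube r' j') ^ q := by
        rw [ENNReal.tsum_mul_left, ENNReal.tsum_comm]
        simp only [Set.inter_comm]
    _ ≤ _ := by
        rw [momentSum]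
        gcongr with j'
        refine (tsum_rpow_le_rpow_tsum _ hq).trans ?_
        rw [tsum_measure_meshCube_inter τ hr]

/-- The number of `r`-mesh cubes meeting an ellipsoid. -/
theorem exists_card_meshCube_le (N : ℕ) (R : ℝ) (hR : 1 ≤ R) :
    ∃ K : ℝ, 0 < K ∧ ∀ (T : Esp N →L[ℝ] Esp N) (x₀ : Esp N) (r : ℝ), 0 < r →
      ∃ F : Finset (Fin N → ℤ), (∀ z, ‖z‖ ≤ R → x₀ + T z ∈ ⋃ j ∈ F, meshCube r j) ∧
        (F.card : ℝ) ≤ K * ∏ i ∈ Finset.range N, max 1 (T.toLinearMap.singularValues i / r) := by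
  refine ⟨(2 * R + 2) ^ N * (N + 2) ^ N, by positivity, fun T x₀ r hr => ?_⟩
  obtain ⟨b, hb⟩ := exists_basis_norm_sq T
  set α : ℕ → ℝ := fun i => T.toLinearMap.singularValues i with hα
  have hα0 : ∀ i, 0 ≤ α i := fun i => LinearMap.singularValues_nonneg _ _
  set J : Set (Fin N → ℤ) := {j | ∃ z, ‖z‖ ≤ R ∧ x₀ + T z ∈ meshCube r j} with hJ
  choose! ζ hζ using (fun j hj => hj : ∀ j ∈ J, ∃ z, ‖z‖ ≤ R ∧ x₀ + T z ∈ meshCube r j)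
  -- A cube meeting the ellipsoid is encoded by the cell of side `r` containing its witness in the
  -- scaled principal coordinates, together with its index modulo `N + 2`. The lower end `-⌊·⌋ - 1`
  -- allows for the floor of a negative number.
  set G : Finset ((Fin N → ℤ) × (Fin N → ℤ)) :=
    (Fintype.piFinset fun i : Fin N => Finset.Icc (-⌊R * α i / r⌋ - 1) ⌊R * α i / r⌋) ×ˢ
      (Fintype.piFinset fun _ => Finset.Ico 0 ((N : ℤ) + 2)) with hG
  set g : (Fin N → ℤ) → (Fin N → ℤ) × (Fin N → ℤ) := fun j =>
    (fun i => ⌊b.repr (ζ j) i * α i / r⌋, fun l => j l % ((N : ℤ) + 2)) with hg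
  have hmaps : ∀ j ∈ J, g j ∈ (G : Set ((Fin N → ℤ) × (Fin N → ℤ))) := by
    intro j hj
    simp only [hG, hg, Finset.coe_product, Set.mem_prod, Finset.mem_coe, Fintype.mem_piFinset,
      Finset.mem_Icc, Finset.mem_Ico]
    refine ⟨fun i => ?_, fun l => ⟨Int.emod_nonneg _ (by omega), Int.emod_lt_of_pos _ (by omega)⟩⟩
    have h1 : |b.repr (ζ j) i| ≤ R := by
      calc |b.repr (ζ j) i| ≤ ‖b.repr (ζ j)‖ := by simpa using PiLp.norm_apply_le (b.repr (ζ j)) i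
        _ = ‖ζ j‖ := b.repr.norm_map _
        _ ≤ R := (hζ j hj).1
    obtain ⟨h2, h3⟩ := abs_le.1 h1
    constructor
    · rw [Int.le_floor]
      push_cast
      have h4 := Int.lt_floor_add_one (R * α i / r)
      have h5 : -(R * α i / r) ≤ b.repr (ζ j) i * α i / r := by
        rw [← neg_div, ← neg_mul]
        have := hα0 i
        gcongr
      linarith
    · have := hα0 i
      gcongr
  -- Witnesses in the same cell have images within `N * r`, so the cube indices differ by less than
  -- `N + 1` in each coordinate; equal residues modulo `N + 2` then force equality.
  have hinj : Set.InjOn g J := by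
    intro j hj j' hj' h
    simp only [hg, Prod.mk.injEq] at h
    obtain ⟨h1, h2⟩ := h
    have hnorm : ‖T (ζ j - ζ j')‖ ≤ N * r := by
      refine abs_le_of_sq_le_sq' ?_ (by positivity) |>.2
      rw [hb]
      have hterm : ∀ i : Fin N, T.toLinearMap.singularValues i ^ 2 *
          (b.repr (ζ j - ζ j') i) ^ 2 ≤ r ^ 2 := by
        intro i
        have h3 := congrFun h1 i
        have h4 := Int.abs_sub_lt_one_of_floor_eq_floor h3
        rw [← sub_div, ← sub_mul, abs_div, abs_of_pos hr, div_lt_one hr] at h4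
        rw [← mul_pow, ← sq_abs]
        gcongr
        rw [mul_comm]
        simpa using h4.le
      calc _ ≤ ∑ i : Fin N, r ^ 2 := Finset.sum_le_sum fun i _ => hterm i
        _ = N * r ^ 2 := by simp
        _ ≤ (N * r) ^ 2 := by
            rw [mul_pow]
            gcongr
            have : N ≤ N ^ 2 := Nat.le_self_pow (by norm_num) N
            exact_mod_cast this
    funext l
    have h5 : |(x₀ + T (ζ j)) l - (x₀ + T (ζ j')) l| ≤ N * r := by
      calc _ = |(T (ζ j - ζ j')) l| := by simp [map_sub]
        _ ≤ ‖T (ζ j - ζ j')‖ := by simpa using PiLp.norm_apply_le (T (ζ j - ζ j')) l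
        _ ≤ _ := hnorm
    obtain ⟨h6, h7⟩ := (hζ j hj).2 l
    obtain ⟨h8, h9⟩ := (hζ j' hj').2 l
    rw [abs_le] at h5
    have h10 : (j l : ℝ) < j' l + (N + 1) := by
      refine lt_of_mul_lt_mul_right (a := r) ?_ hr.le
      linarith [h5.1, h5.2]
    have h11 : (j' l : ℝ) < j l + (N + 1) := by
      refine lt_of_mul_lt_mul_right (a := r) ?_ hr.le
      linarith [h5.1, h5.2]
    have h12 : j l < j' l + (N + 1) := by exact_mod_cast h10
    have h13 : j' l < j l + (N + 1) := by exact_mod_cast h11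
    have h14 : j l % ((N : ℤ) + 2) = j' l % ((N : ℤ) + 2) := congrFun h2 l
    have h15 : ((N : ℤ) + 2) ∣ j l - j' l :=
      Int.dvd_of_emod_eq_zero (Int.emod_eq_emod_iff_emod_sub_eq_zero.1 h14)
    have h16 : j l - j' l = 0 := Int.eq_zero_of_abs_lt_dvd h15 (by rw [abs_lt]; omega)
    omega
  have hfin : J.Finite := Set.Finite.of_injOn hmaps hinj G.finite_toSet
  refine ⟨hfin.toFinset, fun z hz => ?_, ?_⟩
  · simp only [Set.mem_iUnion, exists_prop, Set.Finite.mem_toFinset]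
    exact ⟨fun l => ⌊(x₀ + T z) l / r⌋, ⟨z, hz, (mem_meshCube_iff hr).2 rfl⟩,
      (mem_meshCube_iff hr).2 rfl⟩
  · have hcard : hfin.toFinset.card ≤ G.card :=
      Finset.card_le_card_of_injOn g (fun j hj => hmaps j (by simpa using hj)) (by simpa using hinj)
    calc (hfin.toFinset.card : ℝ) ≤ (G.card : ℝ) := by exact_mod_cast hcard
      _ = (∏ i : Fin N, ((Finset.Icc (-⌊R * α i / r⌋ - 1) ⌊R * α i / r⌋).card : ℝ)) *
            (N + 2) ^ N := by
          rw [hG, Finset.card_product, Fintype.card_piFinset, Fintype.card_piFinset]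
          simp only [Int.card_Ico, sub_zero, Finset.prod_const, Finset.card_univ, Fintype.card_fin]
          rw [show ((N : ℤ) + 2).toNat = N + 2 by omega]
          push_cast
          rfl
      _ ≤ (∏ i : Fin N, (2 * R + 2) * max 1 (α i / r)) * (N + 2) ^ N := by
          gcongr with i
          rw [Int.card_Icc]
          have h0 : 0 ≤ ⌊R * α i / r⌋ := Int.floor_nonneg.2 (by have := hα0 i; positivity)
          have h1 : (((⌊R * α i / r⌋ + 1 - (-⌊R * α i / r⌋ - 1)).toNat : ℤ) : ℝ) =
              2 * (⌊R * α i / r⌋ : ℝ) + 2 := by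
            rw [Int.toNat_of_nonneg (by omega)]; push_cast; ring
          have h2 : ((⌊R * α i / r⌋ + 1 - (-⌊R * α i / r⌋ - 1)).toNat : ℝ) =
              2 * (⌊R * α i / r⌋ : ℝ) + 2 := by exact_mod_cast h1
          rw [h2]
          have h3 := Int.floor_le (R * α i / r)
          have h4 := le_max_left 1 (α i / r)
          have h5 := le_max_right 1 (α i / r)
          have h6 : R * α i / r ≤ R * max 1 (α i / r) := by
            rw [mul_div_assoc]; gcongr
          nlinarith
      _ = _ := by
          rw [Finset.prod_mul_distrib, Finset.prod_const, Finset.card_univ, Fintype.card_fin,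
            Fin.prod_univ_eq_prod_range (fun i => max 1 (α i / r)) N]
          ring

/-! ### Moment sums and the lower dimension -/

/-- The constant disappears because `log C / log r → 0`; division by the negative number `(q - 1)
log r` reverses the inequality. -/
theorem le_lowerDim_of_eventually_le {N : ℕ} (τ : Measure (Esp N)) {q s C : ℝ} (hq : 1 < q)
    (hC : 0 < C)
    (h : ∀ᶠ r in 𝓝[>] (0 : ℝ), momentSum τ q r ≤ ENNReal.ofReal (C * r ^ (s * (q - 1)))) :
    (s : EReal) ≤ lowerDim τ q := by
  have hlim : Tendsto (fun r : ℝ => s + Real.log C / ((q - 1) * Real.log r)) (𝓝[>] 0) (𝓝 s) := by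
    have h1 : Tendsto (fun r : ℝ => (q - 1) * Real.log r) (𝓝[>] 0) atBot :=
      Real.tendsto_log_nhdsGT_zero.const_mul_atBot (by linarith)
    have h2 := h1.const_div_atBot (Real.log C)
    simpa using h2.const_add s
  have hlim' : Tendsto (fun r : ℝ => ((s + Real.log C / ((q - 1) * Real.log r) : ℝ) : EReal))
      (𝓝[>] 0) (𝓝 (s : EReal)) := (continuous_coe_real_ereal.tendsto s).comp hlim
  rw [← hlim'.liminf_eq, lowerDim]
  refine liminf_le_liminf ?_
  have hlt : ∀ᶠ r in 𝓝[>] (0 : ℝ), r ∈ Set.Ioo (0 : ℝ) 1 := Ioo_mem_nhdsGT one_pos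
  filter_upwards [h, hlt] with r hr hr01
  have hlog : Real.log r < 0 := Real.log_neg hr01.1 hr01.2
  have hneg : (q - 1) * Real.log r < 0 := mul_neg_of_pos_of_neg (by linarith) hlog
  have hle : ENNReal.log (momentSum τ q r) ≤
      ((Real.log C + s * ((q - 1) * Real.log r) : ℝ) : EReal) := by
    refine (ENNReal.log_le_log hr).trans ?_
    have hpos : 0 < r ^ (s * (q - 1)) := Real.rpow_pos_of_pos hr01.1 _
    rw [ENNReal.log_ofReal_of_pos (by positivity), Real.log_mul hC.ne' hpos.ne',
      Real.log_rpow hr01.1]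
    refine le_of_eq ?_
    congr 2
    ring
  refine le_trans (le_of_eq ?_) (EReal.div_le_div_right_of_nonpos
    (c := (((q - 1) * Real.log r : ℝ) : EReal)) (by exact_mod_cast hneg.le) hle)
  rw [← EReal.coe_div]
  congr 1
  rw [add_div, mul_div_assoc s, div_self hneg.ne, mul_one, add_comm]

theorem eventually_momentSum_le {N : ℕ} (τ : Measure (Esp N)) {q s : ℝ} (hq : 1 < q)
    (h : (s : EReal) < lowerDim τ q) :
    ∀ᶠ r in 𝓝[>] (0 : ℝ), momentSum τ q r ≤ ENNReal.ofReal (r ^ (s * (q - 1))) := by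
  have hlt : ∀ᶠ r in 𝓝[>] (0 : ℝ), r ∈ Set.Ioo (0 : ℝ) 1 := Ioo_mem_nhdsGT one_pos
  filter_upwards [eventually_lt_of_lt_liminf h, hlt] with r hr hr01
  by_contra hcon
  push Not at hcon
  have hlog : Real.log r < 0 := Real.log_neg hr01.1 hr01.2
  have hneg : (q - 1) * Real.log r < 0 := mul_neg_of_pos_of_neg (by linarith) hlog
  have hle : ((s * ((q - 1) * Real.log r) : ℝ) : EReal) ≤ ENNReal.log (momentSum τ q r) := by
    refine le_trans (le_of_eq ?_) (ENNReal.log_le_log hcon.le)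
    rw [ENNReal.log_ofReal_of_pos (Real.rpow_pos_of_pos hr01.1 _), Real.log_rpow hr01.1]
    congr 1
    ring
  have := EReal.div_le_div_right_of_nonpos (c := (((q - 1) * Real.log r : ℝ) : EReal))
    (by exact_mod_cast hneg.le) hle
  rw [← EReal.coe_div, mul_div_assoc, div_self hneg.ne, mul_one] at this
  exact absurd hr (not_lt.2 this)

/-- Otherwise the moment sum would be at most `r ^ (t (q - 1))` for some `t > s`, which is
eventually below `c * r ^ (s (q - 1))`. -/
theorem lowerDim_le_of_eventually_le {N : ℕ} (τ : Measure (Esp N)) {q s c : ℝ} (hq : 1 < q)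
    (hc : 0 < c)
    (h : ∀ᶠ r in 𝓝[>] (0 : ℝ), ENNReal.ofReal (c * r ^ (s * (q - 1))) ≤ momentSum τ q r) :
    lowerDim τ q ≤ (s : EReal) := by
  by_contra hcon
  push Not at hcon
  obtain ⟨t, hst, ht⟩ := EReal.lt_iff_exists_real_btwn.1 hcon
  have hst : s < t := by exact_mod_cast hst
  have hexp : 0 < (t - s) * (q - 1) := mul_pos (by linarith) (by linarith)
  have hlim : Tendsto (fun r : ℝ => r ^ ((t - s) * (q - 1))) (𝓝[>] 0) (𝓝 0) := by
    have := (Real.continuousAt_rpow_const 0 ((t - s) * (q - 1)) (Or.inr hexp.le)).tendsto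
    rw [Real.zero_rpow hexp.ne'] at this
    exact this.mono_left nhdsWithin_le_nhds
  have hlt : ∀ᶠ r in 𝓝[>] (0 : ℝ), r ∈ Set.Ioo (0 : ℝ) 1 := Ioo_mem_nhdsGT one_pos
  obtain ⟨r, h1, h2, h3, h4⟩ := (h.and ((eventually_momentSum_le τ hq ht).and
    (hlt.and (hlim.eventually_lt_const hc)))).exists
  have h5 := (ENNReal.ofReal_le_ofReal_iff (Real.rpow_nonneg h3.1.le _)).1 (h1.trans h2)
  have h6 : r ^ (t * (q - 1)) = r ^ ((t - s) * (q - 1)) * r ^ (s * (q - 1)) := by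
    rw [← Real.rpow_add h3.1]; congr 1; ring
  rw [h6] at h5
  have := le_of_mul_le_mul_right h5 (Real.rpow_pos_of_pos h3.1 _)
  linarith

theorem le_lowerDim_of_dyadic {N : ℕ} (τ : Measure (Esp N)) {q s : ℝ} (hq : 1 < q) (hs : 0 ≤ s)
    {A : ℝ≥0∞} (hA : A ≠ ∞)
    (h : ∀ n : ℕ, momentSum τ q ((1 / 2) ^ n) ≤
      A * ENNReal.ofReal (((1 / 2 : ℝ) ^ n) ^ (s * (q - 1)))) :
    (s : EReal) ≤ lowerDim τ q := by
  have ht : 0 ≤ s * (q - 1) := mul_nonneg hs (by linarith)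
  -- Adding `1` makes the constant positive, as its logarithm is needed.
  set B : ℝ≥0∞ := ((2 : ℝ≥0∞) ^ N) ^ (q - 1) * A + 1 with hB
  have hBtop : B ≠ ∞ := by
    refine ENNReal.add_ne_top.2 ⟨ENNReal.mul_ne_top (ENNReal.rpow_ne_top_of_nonneg (by linarith)
      (by simp)) hA, by simp⟩
  have hBpos : 0 < B.toReal := ENNReal.toReal_pos (by simp [hB]) hBtop
  refine le_lowerDim_of_eventually_le τ hq (C := B.toReal * 2 ^ (s * (q - 1))) (by positivity) ?_
  have hlt : ∀ᶠ r in 𝓝[>] (0 : ℝ), r ∈ Set.Ioo (0 : ℝ) 1 := Ioo_mem_nhdsGT one_pos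
  filter_upwards [hlt] with r hr
  obtain ⟨n, hn1, hn2⟩ := exists_nat_pow_near_of_lt_one hr.1 hr.2.le
    (by norm_num : (0 : ℝ) < 1 / 2) (by norm_num)
  calc momentSum τ q r ≤ ((2 : ℝ≥0∞) ^ N) ^ (q - 1) * momentSum τ q ((1 / 2) ^ n) :=
        momentSum_le_momentSum τ hq.le hr.1 hn2
    _ ≤ ((2 : ℝ≥0∞) ^ N) ^ (q - 1) *
          (A * ENNReal.ofReal (((1 / 2 : ℝ) ^ n) ^ (s * (q - 1)))) := by gcongr; exact h n
    _ ≤ B * ENNReal.ofReal (((1 / 2 : ℝ) ^ n) ^ (s * (q - 1))) := by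
        rw [← mul_assoc]; gcongr; exact le_self_add
    _ ≤ B * ENNReal.ofReal ((2 * r) ^ (s * (q - 1))) := by
        gcongr
        rw [pow_succ] at hn1
        linarith
    _ = _ := by
        rw [← ENNReal.ofReal_toReal hBtop, ← ENNReal.ofReal_mul hBpos.le,
          Real.mul_rpow zero_le_two hr.1.le, ENNReal.toReal_ofReal hBpos.le]
        ring_nf

/-! ### A power inequality -/

/-- Compare the largest term `M` with the sum `R` of the others. If `R` is small relative to `M`,
the sum is almost `M`. Otherwise the sum is at most `m M`: when `M` is at most a multiple of `z`,
the linear term suffices; when `M / z` is large, the cross terms of `M` with the rest do. The factor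
`1 + δ` must be near `1` because the inequality is iterated over all generations. -/
theorem exists_sum_rpow_le (m : ℕ) {q δ : ℝ} (hq : 1 < q) (hδ : 0 < δ) :
    ∃ C : ℝ, 0 ≤ C ∧ ∀ z : ℝ, 0 < z → ∀ Y : Fin m → ℝ, (∀ a, 0 ≤ Y a) →
      (∑ a, Y a) ^ q ≤ (1 + δ) * ∑ a, Y a ^ q +
        δ * ∑ a, ∑ b ∈ Finset.univ.erase a, Y a ^ q * Y b / z + C * z ^ (q - 1) * ∑ a, Y a := by
  obtain ⟨θ, hθ, hθ'⟩ : ∃ θ : ℝ, 0 < θ ∧ (1 + θ) ^ q ≤ 1 + δ := by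
    refine ⟨(1 + δ) ^ q⁻¹ - 1, ?_, ?_⟩
    · have := Real.one_lt_rpow (x := 1 + δ) (z := q⁻¹) (by linarith) (by positivity)
      linarith
    · rw [add_sub_cancel, ← Real.rpow_mul (by linarith), inv_mul_cancel₀ (by linarith),
        Real.rpow_one]
  -- Chosen so that `m ^ q = δ * θ * L`: when `M > L * z` and `R > θ * M`, the cross term `δ * M ^ q
  -- * R / z` exceeds `(m * M) ^ q`.
  set L : ℝ := (m : ℝ) ^ q / (δ * θ) with hL
  have hL0 : 0 ≤ L := by positivity
  refine ⟨(m : ℝ) ^ q * L ^ (q - 1), by positivity, fun z hz Y hY => ?_⟩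
  have hfirst : 0 ≤ (1 + δ) * ∑ a, Y a ^ q :=
    mul_nonneg (by linarith) (Finset.sum_nonneg fun a _ => Real.rpow_nonneg (hY a) _)
  have hterm : ∀ a, 0 ≤ ∑ b ∈ Finset.univ.erase a, Y a ^ q * Y b / z := fun a =>
    Finset.sum_nonneg fun b _ => div_nonneg (mul_nonneg (Real.rpow_nonneg (hY a) _) (hY b)) hz.le
  have hsecond : 0 ≤ δ * ∑ a, ∑ b ∈ Finset.univ.erase a, Y a ^ q * Y b / z :=
    mul_nonneg hδ.le (Finset.sum_nonneg fun a _ => hterm a)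
  have hthird : 0 ≤ (m : ℝ) ^ q * L ^ (q - 1) * z ^ (q - 1) * ∑ a, Y a :=
    mul_nonneg (by positivity) (Finset.sum_nonneg fun a _ => hY a)
  rcases Nat.eq_zero_or_pos m with rfl | hm
  · simp [Real.zero_rpow (by linarith : q ≠ 0)]
  have : Nonempty (Fin m) := ⟨⟨0, hm⟩⟩
  obtain ⟨a, -, ha⟩ := Finset.exists_max_image Finset.univ Y Finset.univ_nonempty
  have hsum : ∑ b, Y b = Y a + ∑ b ∈ Finset.univ.erase a, Y b :=
    (Finset.add_sum_erase _ _ (Finset.mem_univ a)).symm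
  set M := Y a with hM
  set R := ∑ b ∈ Finset.univ.erase a, Y b with hR
  have hM0 : 0 ≤ M := hY a
  have hR0 : 0 ≤ R := Finset.sum_nonneg fun b _ => hY b
  have hMq : M ^ q ≤ ∑ b, Y b ^ q :=
    Finset.single_le_sum (f := fun b => Y b ^ q) (fun b _ => Real.rpow_nonneg (hY b) _)
      (Finset.mem_univ a)
  by_cases h1 : R ≤ θ * M
  · have : (∑ b, Y b) ^ q ≤ (1 + δ) * ∑ b, Y b ^ q := by
      calc (∑ b, Y b) ^ q ≤ ((1 + θ) * M) ^ q := by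
            rw [hsum]; gcongr; linarith
        _ = (1 + θ) ^ q * M ^ q := Real.mul_rpow (by linarith) hM0
        _ ≤ (1 + δ) * ∑ b, Y b ^ q := by gcongr
    linarith
  push Not at h1
  have h2 : (∑ b, Y b) ^ q ≤ (m : ℝ) ^ q * M ^ q := by
    rw [← Real.mul_rpow (by positivity) hM0]
    have h3 : ∑ b, Y b ≤ m * M := by
      calc ∑ b, Y b ≤ ∑ b : Fin m, M := Finset.sum_le_sum fun b _ => ha b (Finset.mem_univ b)
        _ = m * M := by simp
    have h4 : 0 ≤ ∑ b, Y b := Finset.sum_nonneg fun b _ => hY b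
    gcongr
  by_cases h3 : M ≤ L * z
  · have : (m : ℝ) ^ q * M ^ q ≤ (m : ℝ) ^ q * L ^ (q - 1) * z ^ (q - 1) * ∑ b, Y b := by
      calc (m : ℝ) ^ q * M ^ q = (m : ℝ) ^ q * (M ^ (q - 1) * M) := by
            congr 1
            conv_rhs => rw [← Real.rpow_one M, ← Real.rpow_mul hM0, one_mul]
            rw [← Real.rpow_add_of_nonneg hM0 (by linarith) zero_le_one]
            simp
        _ ≤ (m : ℝ) ^ q * ((L * z) ^ (q - 1) * ∑ b, Y b) := by
            gcongr
            linarith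
        _ = _ := by rw [Real.mul_rpow hL0 hz.le]; ring
    linarith
  · push Not at h3
    have h4 : (m : ℝ) ^ q * M ^ q ≤ δ * ∑ a, ∑ b ∈ Finset.univ.erase a, Y a ^ q * Y b / z := by
      have h5 : M ^ q * R / z ≤ ∑ a, ∑ b ∈ Finset.univ.erase a, Y a ^ q * Y b / z := by
        refine le_trans (le_of_eq ?_) (Finset.single_le_sum
          (f := fun a => ∑ b ∈ Finset.univ.erase a, Y a ^ q * Y b / z)
          (fun a _ => hterm a) (Finset.mem_univ a))
        rw [← Finset.sum_div, ← Finset.mul_sum]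
      refine le_trans ?_ (mul_le_mul_of_nonneg_left h5 hδ.le)
      have h6 : L ≤ M / z := by rw [le_div_iff₀ hz]; exact h3.le
      have h7 : (m : ℝ) ^ q = δ * θ * L := by rw [hL]; field_simp
      calc (m : ℝ) ^ q * M ^ q = δ * (M ^ q * (θ * L)) := by rw [h7]; ring
        _ ≤ δ * (M ^ q * (θ * (M / z))) := by gcongr
        _ = δ * (M ^ q * (θ * M) / z) := by ring
        _ ≤ δ * (M ^ q * R / z) := by gcongr
    linarith

theorem exists_ennreal_sum_rpow_le (m : ℕ) {q : ℝ} {δ : ℝ≥0} (hq : 1 < q) (hδ : 0 < δ) :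
    ∃ C : ℝ≥0, ∀ z : ℝ≥0∞, z ≠ 0 → z ≠ ∞ → ∀ Y : Fin m → ℝ≥0∞, (∀ a, Y a ≠ ∞) →
      (∑ a, Y a) ^ q ≤ (1 + δ) * ∑ a, Y a ^ q +
        δ * ∑ a, ∑ b ∈ Finset.univ.erase a, Y a ^ q * Y b / z + C * z ^ (q - 1) * ∑ a, Y a := by
  obtain ⟨C, hC, h⟩ := exists_sum_rpow_le m hq (δ := δ) (by exact_mod_cast hδ)
  lift C to ℝ≥0 using hC
  refine ⟨C, fun z hz hz' Y hY => ?_⟩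
  lift z to ℝ≥0 using hz'
  lift Y to Fin m → ℝ≥0 using hY
  have hz0 : z ≠ 0 := by simpa using hz
  have hzpos : 0 < z := pos_iff_ne_zero.2 hz0
  have hq0 : 0 ≤ q := by linarith
  have hq1 : 0 ≤ q - 1 := by linarith
  have := h z (by exact_mod_cast hzpos) (fun a => Y a) (fun a => (Y a).2)
  have h2 : (∑ a, Y a) ^ q ≤ (1 + δ) * ∑ a, Y a ^ q +
        δ * ∑ a, ∑ b ∈ Finset.univ.erase a, Y a ^ q * Y b / z +
        C * z ^ (q - 1) * ∑ a, Y a := by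
    rw [← NNReal.coe_le_coe]
    push_cast
    exact this
  simp only [← ENNReal.coe_rpow_of_nonneg _ hq0, ← ENNReal.coe_rpow_of_nonneg _ hq1,
    ← ENNReal.ofNNReal_finsetSum, ← ENNReal.coe_mul, ← ENNReal.coe_div hz0, ← ENNReal.coe_one,
    ← ENNReal.coe_add]
  exact ENNReal.coe_le_coe.2 h2

/-! ### Words and cylinders -/

/-- The word obtained by deleting the first `k` letters. -/
def dropFirst {m : ℕ} (k : ℕ) (i : CodeSpace m) : CodeSpace m := fun n => i (k + n)

theorem length_curtail {m : ℕ} (i : CodeSpace m) (k : ℕ) : (curtail i k).length = k := by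
  simp [curtail]

theorem curtail_zero {m : ℕ} (i : CodeSpace m) : curtail i 0 = [] := by simp [curtail]

theorem curtail_succ {m : ℕ} (i : CodeSpace m) (k : ℕ) :
    curtail i (k + 1) = curtail i k ++ [i k] := by
  rw [curtail, List.ofFn_succ', List.concat_eq_append]
  rfl

theorem curtail_add {m : ℕ} (i : CodeSpace m) (k l : ℕ) :
    curtail i (k + l) = curtail i k ++ curtail (dropFirst k i) l := by
  induction l with
  | zero => simp [curtail_zero]
  | succ l ih => rw [← add_assoc, curtail_succ, ih, curtail_succ, List.append_assoc, dropFirst]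

theorem mem_wordCylinder_append {m : ℕ} {w : List (Fin m)} {a : Fin m} {i : CodeSpace m} :
    i ∈ wordCylinder (w ++ [a]) ↔ i ∈ wordCylinder w ∧ i w.length = a := by
  simp only [wordCylinder, Set.mem_ofPred_eq, List.length_append, List.length_singleton,
    curtail_succ]
  constructor
  · intro h
    have := List.append_inj h (length_curtail _ _)
    simpa using this
  · rintro ⟨h1, h2⟩
    rw [h1, h2]

theorem measurable_restrictFirst {m : ℕ} (k : ℕ) :
    Measurable fun (i : CodeSpace m) (l : Fin k) => i l :=
  measurable_pi_lambda _ fun _ => measurable_pi_apply _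

theorem measurableSet_wordCylinder {m : ℕ} (w : List (Fin m)) :
    MeasurableSet (wordCylinder w) := by
  have : wordCylinder w =
      (fun (i : CodeSpace m) (l : Fin w.length) => i l) ⁻¹' {v | List.ofFn v = w} := rfl
  rw [this]
  exact measurable_restrictFirst _ (Set.toFinite _).measurableSet

theorem measure_wordCylinder_inter {m : ℕ} (μ : Measure (CodeSpace m)) (w : List (Fin m))
    (A : Set (CodeSpace m)) :
    μ (wordCylinder w ∩ A) = ∑ a, μ (wordCylinder (w ++ [a]) ∩ A) := by
  have h1 : wordCylinder w = ⋃ a, wordCylinder (w ++ [a]) := by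
    ext i
    simp [mem_wordCylinder_append]
  have h2 : Pairwise (Function.onFun Disjoint fun a : Fin m => wordCylinder (w ++ [a])) := by
    intro a b hab
    refine Set.disjoint_left.2 fun i hi hi' => hab ?_
    rw [mem_wordCylinder_append] at hi hi'
    exact hi.2.symm.trans hi'.2
  have h3 := measure_iUnion (μ := μ.restrict A) h2 fun a => measurableSet_wordCylinder (w ++ [a])
  rw [← h1, tsum_fintype, Measure.restrict_apply (measurableSet_wordCylinder w)] at h3
  simpa [Measure.restrict_apply (measurableSet_wordCylinder _)] using h3

theorem measure_wordCylinder {m : ℕ} (μ : Measure (CodeSpace m)) (w : List (Fin m)) :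
    μ (wordCylinder w) = ∑ a, μ (wordCylinder (w ++ [a])) := by
  simpa using measure_wordCylinder_inter μ w Set.univ

theorem wordCylinder_nil {m : ℕ} : wordCylinder ([] : List (Fin m)) = Set.univ := by
  ext i; simp [wordCylinder, curtail_zero]

theorem sum_ofFn_succ {m : ℕ} {M : Type*} [AddCommMonoid M] (f : List (Fin m) → M) (k : ℕ) :
    ∑ i : Fin (k + 1) → Fin m, f (List.ofFn i) =
      ∑ i : Fin k → Fin m, ∑ a, f (List.ofFn i ++ [a]) := by
  rw [← (Fin.snocEquiv fun _ : Fin (k + 1) => Fin m).sum_comp, Fintype.sum_prod_type_right]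
  refine Finset.sum_congr rfl fun i _ => Finset.sum_congr rfl fun a _ => ?_
  congr 1
  rw [List.ofFn_succ', List.concat_eq_append]
  simp [Fin.snocEquiv]

/-! ### Products of contractions -/

theorem exists_norm_le {m N : ℕ} (T : Fin m → Esp N →L[ℝ] Esp N) (hT : ∀ i, ‖T i‖ < 1) :
    ∃ α : ℝ, 0 < α ∧ α < 1 ∧ ∀ i, ‖T i‖ ≤ α := by
  rcases isEmpty_or_nonempty (Fin m) with h | h
  · exact ⟨1 / 2, by norm_num, by norm_num, fun i => h.elim i⟩
  obtain ⟨a, -, ha⟩ := Finset.exists_max_image Finset.univ (fun i => ‖T i‖) Finset.univ_nonempty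
  exact ⟨max ‖T a‖ (1 / 2), by positivity, max_lt (hT a) (by norm_num),
    fun i => le_max_of_le_left (ha i (Finset.mem_univ i))⟩

theorem wordMap_append {m N : ℕ} (T : Fin m → Esp N →L[ℝ] Esp N) (v w : List (Fin m)) (x : Esp N) :
    wordMap T (v ++ w) x = wordMap T v (wordMap T w x) := by
  simp [wordMap]

theorem norm_wordMap_le {m N : ℕ} {T : Fin m → Esp N →L[ℝ] Esp N} {α : ℝ} (hα : 0 < α)
    (hT : ∀ i, ‖T i‖ ≤ α) (w : List (Fin m)) : ‖wordMap T w‖ ≤ α ^ w.length := by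
  induction w with
  | nil => exact ContinuousLinearMap.norm_id_le
  | cons a w ih =>
    have : wordMap T (a :: w) = T a * wordMap T w := by simp [wordMap]
    rw [this, List.length_cons, pow_succ']
    exact (norm_mul_le _ _).trans (mul_le_mul (hT a) ih (norm_nonneg _) hα.le)

theorem wordMap_injective {m N : ℕ} {T : Fin m → Esp N →L[ℝ] Esp N}
    (hT : ∀ i, Function.Injective (T i)) (w : List (Fin m)) :
    Function.Injective (wordMap T w) := by
  induction w with
  | nil => simpa [wordMap] using Function.injective_id
  | cons a w ih =>
    have : wordMap T (a :: w) = T a * wordMap T w := by simp [wordMap]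
    rw [this]
    exact (hT a).comp ih

/-! ### The projection -/

theorem norm_proj_term_le {m N : ℕ} {T : Fin m → Esp N →L[ℝ] Esp N} {α : ℝ} (hα : 0 < α)
    (hT : ∀ i, ‖T i‖ ≤ α) {ω : List (Fin m) → Esp N} {R : ℝ} (hω : ∀ w, ‖ω w‖ ≤ R)
    (i : CodeSpace m) (k : ℕ) :
    ‖wordMap T (curtail i k) (ω (curtail i (k + 1)))‖ ≤ R * α ^ k := by
  have h := norm_wordMap_le hα hT (curtail i k)
  rw [length_curtail] at h
  calc _ ≤ ‖wordMap T (curtail i k)‖ * ‖ω (curtail i (k + 1))‖ := ContinuousLinearMap.le_opNorm _ _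
    _ ≤ α ^ k * R := mul_le_mul h (hω _) (norm_nonneg _) (by positivity)
    _ = _ := mul_comm _ _

theorem summable_proj {m N : ℕ} {T : Fin m → Esp N →L[ℝ] Esp N} {α : ℝ} (hα : 0 < α) (hα1 : α < 1)
    (hT : ∀ i, ‖T i‖ ≤ α) {ω : List (Fin m) → Esp N} {R : ℝ} (hω : ∀ w, ‖ω w‖ ≤ R)
    (i : CodeSpace m) :
    Summable fun k => wordMap T (curtail i k) (ω (curtail i (k + 1))) :=
  Summable.of_norm_bounded ((summable_geometric_of_lt_one hα.le hα1).mul_left R)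
    (norm_proj_term_le hα hT hω i)

theorem norm_proj_le {m N : ℕ} {T : Fin m → Esp N →L[ℝ] Esp N} {α : ℝ} (hα : 0 < α) (hα1 : α < 1)
    (hT : ∀ i, ‖T i‖ ≤ α) {ω : List (Fin m) → Esp N} {R : ℝ} (hω : ∀ w, ‖ω w‖ ≤ R)
    (i : CodeSpace m) : ‖proj T ω i‖ ≤ R * (1 - α)⁻¹ :=
  tsum_of_norm_bounded ((hasSum_geometric_of_lt_one hα.le hα1).mul_left R)
    (norm_proj_term_le hα hT hω i)

/-- The finite sum reads only displacements of prefixes of length at most `k`, and the remainder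
only those of longer words. This separation is what independence is applied to. -/
theorem proj_eq_sum_add {m N : ℕ} {T : Fin m → Esp N →L[ℝ] Esp N} {α : ℝ} (hα : 0 < α)
    (hα1 : α < 1) (hT : ∀ i, ‖T i‖ ≤ α) {ω : List (Fin m) → Esp N} {R : ℝ} (hω : ∀ w, ‖ω w‖ ≤ R)
    (i : CodeSpace m) (k : ℕ) :
    proj T ω i = ∑ l ∈ Finset.range k, wordMap T (curtail i l) (ω (curtail i (l + 1))) +
      wordMap T (curtail i k) (proj T (fun u => ω (curtail i k ++ u)) (dropFirst k i)) := by
  rw [proj, ← (summable_proj hα hα1 hT hω i).sum_add_tsum_nat_add k, proj,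
    ContinuousLinearMap.map_tsum _ (summable_proj hα hα1 hT (fun u => hω _) _)]
  congr 1
  refine tsum_congr fun l => ?_
  rw [add_comm l k, add_assoc k l 1, curtail_add, curtail_add, wordMap_append]

theorem proj_congr {m N : ℕ} (T : Fin m → Esp N →L[ℝ] Esp N) {ω ω' : List (Fin m) → Esp N}
    {i : CodeSpace m} (h : ∀ k, ω (curtail i (k + 1)) = ω' (curtail i (k + 1))) :
    proj T ω i = proj T ω' i :=
  tsum_congr fun k => by rw [h]

/-- The projection is jointly measurable in the displacements and the word. -/
theorem measurable_proj {m N : ℕ} {T : Fin m → Esp N →L[ℝ] Esp N} {α : ℝ} (hα : 0 < α)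
    (hα1 : α < 1) (hT : ∀ i, ‖T i‖ ≤ α) {Ω : Type*} [MeasurableSpace Ω]
    {ω : List (Fin m) → Ω → Esp N} {R : ℝ} (hω : ∀ w x, ‖ω w x‖ ≤ R)
    (hmeas : ∀ w, Measurable (ω w)) :
    Measurable fun p : Ω × CodeSpace m => proj T (fun w => ω w p.1) p.2 := by
  have hterm : ∀ k, Measurable fun p : Ω × CodeSpace m =>
      wordMap T (curtail p.2 k) (ω (curtail p.2 (k + 1)) p.1) := by
    intro k
    -- The term depends on the word only through its first `k + 1` letters, which take finitely many
    -- values, so each may be fixed.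
    have h1 : Measurable fun p : Ω × (Fin (k + 1) → Fin m) =>
        wordMap T (List.ofFn fun l : Fin k => p.2 l.castSucc) (ω (List.ofFn p.2) p.1) :=
      measurable_from_prod_countable_left fun v =>
        (wordMap T (List.ofFn fun l : Fin k => v l.castSucc)).measurable.comp (hmeas (List.ofFn v))
    exact h1.comp (measurable_fst.prodMk ((measurable_restrictFirst (k + 1)).comp measurable_snd))
  refine measurable_of_tendsto_metrizable
    (f := fun n (p : Ω × CodeSpace m) => ∑ k ∈ Finset.range n,
      wordMap T (curtail p.2 k) (ω (curtail p.2 (k + 1)) p.1))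
    (fun n => Finset.measurable_fun_sum _ fun k _ => hterm k) ?_
  refine tendsto_pi_nhds.2 fun p => ?_
  exact (summable_proj hα hα1 hT (fun w => hω w p.1) p.2).hasSum.tendsto_sum_nat

theorem measurable_proj_apply {m N : ℕ} {T : Fin m → Esp N →L[ℝ] Esp N} {α : ℝ} (hα : 0 < α)
    (hα1 : α < 1) (hT : ∀ i, ‖T i‖ ≤ α) {ω : List (Fin m) → Esp N} {R : ℝ}
    (hω : ∀ w, ‖ω w‖ ≤ R) : Measurable (proj T ω) :=
  (measurable_proj hα hα1 hT (Ω := Unit) (ω := fun w _ => ω w) (fun w _ => hω w)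
    fun _ => measurable_const).comp (measurable_prodMk_left (x := ()))

/-! ### Independence of displacements on disjoint sets of words -/

/-- A bounded family of independent, identically and absolutely continuously distributed vectors. -/
structure IsBoundedIID {m N : ℕ} {Ω : Type*} [MeasurableSpace Ω] (P : Measure Ω)
    (ω : List (Fin m) → Ω → Esp N) (R : ℝ) : Prop where
  meas : ∀ w, Measurable (ω w)
  indep : iIndepFun ω P
  ident : ∀ v w, IdentDistrib (ω v) (ω w) P P
  ac : ∀ w, P.map (ω w) ≪ volume
  bound : ∀ w x, ‖ω w x‖ ≤ R

/-- The σ-algebra generated by the displacements of the words in `S`. -/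
@[reducible]
def sigmaOn {m N : ℕ} {Ω : Type*} (ω : List (Fin m) → Ω → Esp N) (S : Set (List (Fin m))) :
    MeasurableSpace Ω :=
  ⨆ u ∈ S, MeasurableSpace.comap (ω u) inferInstance

theorem measurable_sigmaOn {m N : ℕ} {Ω : Type*} (ω : List (Fin m) → Ω → Esp N)
    {S : Set (List (Fin m))} {u : List (Fin m)} (hu : u ∈ S) : Measurable[sigmaOn ω S] (ω u) :=
  measurable_iff_comap_le.2 (le_iSup₂_of_le u hu le_rfl)

section Independence

variable {m N : ℕ} {Ω : Type*} [mΩ : MeasurableSpace Ω] {P : Measure Ω}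
  {ω : List (Fin m) → Ω → Esp N} {R : ℝ}

theorem sigmaOn_le (h : IsBoundedIID P ω R) (S : Set (List (Fin m))) : sigmaOn ω S ≤ mΩ :=
  iSup₂_le fun u _ => (h.meas u).comap_le

theorem indepFun_of_sigmaOn (h : IsBoundedIID P ω R) {S S' : Set (List (Fin m))}
    (hS : Disjoint S S') {β γ : Type*} [MeasurableSpace β] [MeasurableSpace γ] {f : Ω → β}
    {g : Ω → γ} (hf : Measurable[sigmaOn ω S] f) (hg : Measurable[sigmaOn ω S'] g) :
    IndepFun f g P := by
  rw [IndepFun_iff_Indep]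
  exact indep_of_indep_of_le (indep_iSup_of_disjoint (fun u => (h.meas u).comap_le)
    h.indep.iIndep hS) hf.comap_le hg.comap_le

theorem lintegral_indepFun [IsProbabilityMeasure P] {β γ : Type*} [MeasurableSpace β]
    [MeasurableSpace γ] {f : Ω → β} {g : Ω → γ} (hf : Measurable f) (hg : Measurable g)
    (hfg : IndepFun f g P) {F : β × γ → ℝ≥0∞} (hF : Measurable F) :
    ∫⁻ x, F (f x, g x) ∂P = ∫⁻ x, ∫⁻ y, F (f x, g y) ∂P ∂P := by
  have h := (indepFun_iff_map_prod_eq_prod_map_map hf.aemeasurable hg.aemeasurable).1 hfg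
  rw [← lintegral_map (f := F) (g := fun x => (f x, g x)) hF (hf.prodMk hg), h,
    lintegral_prod _ hF.aemeasurable, lintegral_map hF.lintegral_prod_right' hf]
  refine lintegral_congr fun x => ?_
  exact lintegral_map (f := fun y => F (f x, y)) (hF.comp measurable_prodMk_left) hg

/-- The restriction of the displacements to `S`, jointly with the word. -/
theorem measurable_proj_indicator (h : IsBoundedIID P ω R) {T : Fin m → Esp N →L[ℝ] Esp N} {α : ℝ}
    (hα : 0 < α) (hα1 : α < 1) (hT : ∀ i, ‖T i‖ ≤ α) (S : Set (List (Fin m)))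
    (w : List (Fin m)) :
    @Measurable _ _ (@Prod.instMeasurableSpace _ _ (sigmaOn ω S) inferInstance) _
      fun p : Ω × CodeSpace m =>
        proj T (fun u => S.indicator (fun u => ω u p.1) (w ++ u)) p.2 := by
  classical
  refine @measurable_proj m N T α hα hα1 hT Ω (sigmaOn ω S)
    (fun u x => S.indicator (fun u => ω u x) (w ++ u)) R (fun u x => ?_) (fun u => ?_)
  · rw [Set.indicator_apply]
    split_ifs
    · exact h.bound _ _
    · simpa using (norm_nonneg _).trans (h.bound [] x)
  · by_cases hu : w ++ u ∈ S
    · simp only [Set.indicator_of_mem hu]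
      exact measurable_sigmaOn ω hu
    · simp only [Set.indicator_of_notMem hu]
      exact @measurable_const _ _ _ (sigmaOn ω S) _

/-- A word that reads only displacements in `S` does not notice when all others are replaced by `0`;
after the replacement, measurability for `sigmaOn ω S` is clear. -/
theorem measurable_proj_of_mem (h : IsBoundedIID P ω R) {T : Fin m → Esp N →L[ℝ] Esp N} {α : ℝ}
    (hα : 0 < α) (hα1 : α < 1) (hT : ∀ i, ‖T i‖ ≤ α) {S : Set (List (Fin m))}
    {w : List (Fin m)} {j : CodeSpace m} (hj : ∀ k, w ++ curtail j (k + 1) ∈ S) :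
    Measurable[sigmaOn ω S] fun x => proj T (fun u => ω (w ++ u) x) j := by
  have h1 := measurable_proj_indicator h hα hα1 hT S w
  have h2 : (fun x => proj T (fun u => ω (w ++ u) x) j) =
      (fun p : Ω × CodeSpace m => proj T (fun u => S.indicator (fun u => ω u p.1) (w ++ u)) p.2) ∘
        fun x => (x, j) := by
    funext x
    refine proj_congr (ω' := fun u => S.indicator (fun u => ω u x) (w ++ u)) T fun k => ?_
    exact (Set.indicator_of_mem (hj k) fun u => ω u x).symm
  rw [h2]
  exact h1.comp (@measurable_prodMk_right _ _ (sigmaOn ω S) _ j)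

theorem measurable_measure_cylinder (h : IsBoundedIID P ω R) {T : Fin m → Esp N →L[ℝ] Esp N}
    {α : ℝ} (hα : 0 < α) (hα1 : α < 1) (hT : ∀ i, ‖T i‖ ≤ α) (μ : Measure (CodeSpace m))
    [IsFiniteMeasure μ] {S : Set (List (Fin m))} {v : List (Fin m)}
    (hv : ∀ j ∈ wordCylinder v, ∀ k, curtail j (k + 1) ∈ S) {C : Set (Esp N)}
    (hC : MeasurableSet C) :
    Measurable[sigmaOn ω S] fun x =>
      μ (wordCylinder v ∩ proj T (fun u => ω u x) ⁻¹' C) := by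
  have h1 := measurable_proj_indicator h hα hα1 hT S []
  have h2 : ∀ x, wordCylinder v ∩ proj T (fun u => ω u x) ⁻¹' C =
      Prod.mk x ⁻¹' ({p : Ω × CodeSpace m | p.2 ∈ wordCylinder v} ∩
        (fun p : Ω × CodeSpace m =>
          proj T (fun u => S.indicator (fun u => ω u p.1) ([] ++ u)) p.2) ⁻¹' C) := by
    intro x
    ext j
    simp only [Set.mem_inter_iff, Set.mem_preimage, Set.mem_ofPred_eq]
    refine and_congr_right fun hj => ?_
    have h3 : proj T (fun u => ω u x) j =
        proj T (fun u => S.indicator (fun u => ω u x) ([] ++ u)) j :=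
      proj_congr T fun k => (Set.indicator_of_mem (hv j hj k) fun u => ω u x).symm
    rw [h3]
  simp only [h2]
  refine @measurable_measure_prodMk_left _ _ (sigmaOn ω S) _ μ _ _ ?_
  have h3 : @Measurable _ _ (@Prod.instMeasurableSpace _ _ (sigmaOn ω S) inferInstance) _
      (Prod.snd : Ω × CodeSpace m → CodeSpace m) := @measurable_snd _ _ (sigmaOn ω S) _
  exact (h3 (measurableSet_wordCylinder v)).inter (h1 hC)

end Independence

/-! ### The projections have bounded densities -/

/-- An absolutely continuous finite measure is the sum of a measure with bounded density and a
small one. -/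
theorem exists_le_smul_add {E : Type*} [MeasurableSpace E] (ρ ν : Measure E) [IsFiniteMeasure ρ]
    [SigmaFinite ν] (hρ : ρ ≪ ν) {η : ℝ≥0∞} (hη : 0 < η) :
    ∃ (K : ℝ≥0) (κ : Measure E), κ Set.univ ≤ η ∧ ρ ≤ (K : ℝ≥0∞) • ν + κ := by
  set f := ρ.rnDeriv ν with hf
  have hfm : Measurable f := Measure.measurable_rnDeriv ρ ν
  have hlim : Tendsto (fun n : ℕ => ∫⁻ x, f x - n ∂ν) atTop (𝓝 (∫⁻ _, 0 ∂ν)) := by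
    refine tendsto_lintegral_of_dominated_convergence f (fun n => hfm.sub_const _)
      (fun n => Eventually.of_forall fun x => tsub_le_self) ?_ ?_
    · exact (Measure.lintegral_rnDeriv_lt_top ρ ν).ne
    · filter_upwards [Measure.rnDeriv_lt_top ρ ν] with x hx
      obtain ⟨n, hn⟩ := ENNReal.exists_nat_gt hx.ne
      refine tendsto_const_nhds.congr' ?_
      filter_upwards [eventually_ge_atTop n] with k hk
      rw [tsub_eq_zero_of_le]
      exact hn.le.trans (by exact_mod_cast hk)
  rw [lintegral_zero] at hlim
  obtain ⟨n, hn⟩ := (hlim.eventually_lt_const hη).exists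
  refine ⟨n, ν.withDensity fun x => f x - n, ?_, ?_⟩
  · rw [withDensity_apply _ MeasurableSet.univ, Measure.restrict_univ]
    exact hn.le
  · conv_lhs => rw [← Measure.withDensity_rnDeriv_eq ρ ν hρ]
    refine Measure.le_iff.2 fun s hs => ?_
    rw [withDensity_apply _ hs, Measure.add_apply, withDensity_apply _ hs, Measure.smul_apply]
    calc ∫⁻ x in s, f x ∂ν ≤ ∫⁻ x in s, n + (f x - n) ∂ν :=
          lintegral_mono fun x => le_add_tsub
      _ = _ := by
          rw [lintegral_add_left measurable_const]
          simp

/-- Split the law of `X`. Its part below `K • volume`, shifted by the independent `T Z`, stays below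
`K • volume` by translation invariance; for the small part `κ`, fix `X` and use the assumed bound
for `Z`, at the price of the determinant factor `d`. -/
theorem measure_add_map_mem_le {N : ℕ} {Ω : Type*} [MeasurableSpace Ω] {P : Measure Ω}
    [IsProbabilityMeasure P] {X Z : Ω → Esp N} (hX : Measurable X) (hZ : Measurable Z)
    (hXZ : IndepFun X Z P) {K η c d e : ℝ≥0∞} (hη : η ≠ ∞) {κ : Measure (Esp N)}
    (hκ : κ Set.univ ≤ η) (hK : P.map X ≤ K • volume + κ) {T : Esp N →L[ℝ] Esp N}
    (hdet : ∀ A, volume (T ⁻¹' A) ≤ d * volume A)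
    (hle : ∀ A, MeasurableSet A → P (Z ⁻¹' A) ≤ c * volume A + e)
    {A : Set (Esp N)} (hA : MeasurableSet A) :
    P ((fun x => X x + T (Z x)) ⁻¹' A) ≤ (K + η * d * c) * volume A + η * e := by
  have : IsFiniteMeasure κ := ⟨hκ.trans_lt hη.lt_top⟩
  have : IsProbabilityMeasure (P.map Z) := Measure.isProbabilityMeasure_map hZ.aemeasurable
  set S : Set (Esp N × Esp N) := (fun p => p.1 + T p.2) ⁻¹' A with hS
  have hSm : MeasurableSet S :=
    (measurable_fst.add (T.measurable.comp measurable_snd)) hA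
  have hsec : ∀ z, volume ((fun a : Esp N => (a, z)) ⁻¹' S) = volume A := fun z =>
    measure_preimage_add_right volume (T z) A
  have h1 : P ((fun x => X x + T (Z x)) ⁻¹' A) = ((P.map X).prod (P.map Z)) S := by
    rw [← (indepFun_iff_map_prod_eq_prod_map_map hX.aemeasurable hZ.aemeasurable).1 hXZ,
      Measure.map_apply (hX.prodMk hZ) hSm]
    rfl
  have h2 : (κ.prod (P.map Z)) S ≤ η * d * c * volume A + η * e := by
    rw [Measure.prod_apply hSm]
    calc ∫⁻ a, P.map Z (Prod.mk a ⁻¹' S) ∂κ ≤ ∫⁻ _, c * (d * volume A) + e ∂κ := by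
          refine lintegral_mono fun a => ?_
          rw [Measure.map_apply hZ (measurable_prodMk_left hSm)]
          refine (hle _ (measurable_prodMk_left hSm)).trans ?_
          gcongr
          refine (hdet ((fun y => a + y) ⁻¹' A)).trans (le_of_eq ?_)
          rw [measure_preimage_add]
      _ = (c * (d * volume A) + e) * κ Set.univ := lintegral_const _
      _ ≤ (c * (d * volume A) + e) * η := by gcongr
      _ = _ := by ring
  rw [h1, Measure.prod_apply_symm hSm]
  calc ∫⁻ z, P.map X ((fun a => (a, z)) ⁻¹' S) ∂(P.map Z)
      ≤ ∫⁻ z, K * volume A + κ ((fun a => (a, z)) ⁻¹' S) ∂(P.map Z) := by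
        refine lintegral_mono fun z => (hK _).trans ?_
        rw [Measure.add_apply, Measure.smul_apply, hsec, smul_eq_mul]
    _ = K * volume A + (κ.prod (P.map Z)) S := by
        rw [lintegral_add_left measurable_const, Measure.prod_apply_symm hSm]
        simp
    _ ≤ K * volume A + (η * d * c * volume A + η * e) := by gcongr
    _ = _ := by ring

theorem exists_det_bound {m N : ℕ} (T : Fin m → Esp N →L[ℝ] Esp N)
    (hT : ∀ i, Function.Injective (T i)) :
    ∃ d : ℝ≥0∞, d ≠ ∞ ∧ ∀ i A, volume (T i ⁻¹' A) ≤ d * volume A := by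
  have hdet : ∀ i, LinearMap.det (T i).toLinearMap ≠ 0 := fun i => by
    have := LinearMap.isUnit_iff_ker_eq_bot (T i).toLinearMap |>.2 (LinearMap.ker_eq_bot.2 (hT i))
    exact (LinearMap.isUnit_det _ this).ne_zero
  refine ⟨∑ i, ENNReal.ofReal |(LinearMap.det (T i).toLinearMap)⁻¹|, by simp, fun i A => ?_⟩
  have h := Measure.addHaar_preimage_linearMap volume (hdet i) A
  refine h.le.trans ?_
  gcongr
  exact Finset.single_le_sum (f := fun i => ENNReal.ofReal |(LinearMap.det (T i).toLinearMap)⁻¹|)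
    (fun _ _ => zero_le) (Finset.mem_univ i)

/-- The random points `Π^ω(j)` have uniformly bounded densities. -/
theorem exists_density_bound {m N : ℕ} {Ω : Type*} [MeasurableSpace Ω] {P : Measure Ω}
    [IsProbabilityMeasure P] {ω : List (Fin m) → Ω → Esp N} {R : ℝ} (h : IsBoundedIID P ω R)
    {T : Fin m → Esp N →L[ℝ] Esp N} (hTinj : ∀ i, Function.Injective (T i)) {α : ℝ}
    (hα : 0 < α) (hα1 : α < 1) (hT : ∀ i, ‖T i‖ ≤ α) :
    ∃ K : ℝ≥0, ∀ (w : List (Fin m)) (j : CodeSpace m) (A : Set (Esp N)), MeasurableSet A →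
      P ((fun x => proj T (fun u => ω (w ++ u) x) j) ⁻¹' A) ≤ K * volume A := by
  obtain ⟨d, hd, hdet⟩ := exists_det_bound T hTinj
  -- With `η * d ≤ 1/2` the density constant `2 * K` reproduces itself, `K + η * d * (2 * K) ≤ 2 *
  -- K`, while `η ≤ 1/2` makes the error `η ^ n` vanish in the limit.
  set η : ℝ≥0∞ := 2⁻¹ * (d + 1)⁻¹ with hη
  have hd1 : d + 1 ≠ ∞ := by simp [hd]
  have hη0 : 0 < η := ENNReal.mul_pos (by simp) (ENNReal.inv_ne_zero.2 hd1)
  have hηtwo : η ≤ 2⁻¹ := by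
    calc η ≤ 2⁻¹ * 1 := by
          rw [hη]; gcongr
          exact ENNReal.inv_le_one.2 le_add_self
      _ = _ := mul_one _
  have hηd : η * d ≤ 2⁻¹ := by
    calc η * d ≤ 2⁻¹ * (d + 1)⁻¹ * (d + 1) := by rw [hη]; gcongr; exact le_self_add
      _ = 2⁻¹ := by rw [mul_assoc, ENNReal.inv_mul_cancel (by simp) hd1, mul_one]
  have hηtop : η ≠ ∞ := (hηtwo.trans_lt (by simp)).ne
  have : IsProbabilityMeasure (P.map (ω [])) :=
    Measure.isProbabilityMeasure_map (h.meas []).aemeasurable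
  obtain ⟨K, κ, hκ, hK⟩ := exists_le_smul_add (P.map (ω [])) volume (h.ac []) hη0
  -- Each step peels off the first displacement, independent of the rest of the series. The base
  -- case is trivial, the error being `η ^ 0 = 1`.
  have key : ∀ (n : ℕ) (w : List (Fin m)) (j : CodeSpace m) (A : Set (Esp N)), MeasurableSet A →
      P ((fun x => proj T (fun u => ω (w ++ u) x) j) ⁻¹' A) ≤ (2 * K) * volume A + η ^ n := by
    intro n
    induction n with
    | zero =>
      intro w j A _
      rw [pow_zero]
      exact prob_le_one.trans le_add_self
    | succ n ih =>
      intro w j A hA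
      have hdec : (fun x => proj T (fun u => ω (w ++ u) x) j) = fun x => ω (w ++ [j 0]) x +
          T (j 0) (proj T (fun u => ω (w ++ [j 0] ++ u) x) (dropFirst 1 j)) := by
        funext x
        rw [proj_eq_sum_add hα hα1 hT (fun u => h.bound _ x) j 1]
        have : curtail j 1 = [j 0] := by simp [curtail]
        simp [this, curtail_zero, wordMap]
      rw [hdec]
      have hX : Measurable[sigmaOn ω {w ++ [j 0]}] (ω (w ++ [j 0])) :=
        measurable_sigmaOn ω rfl
      have hZ : Measurable[sigmaOn ω {u | u ≠ w ++ [j 0]}]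
          fun x => proj T (fun u => ω (w ++ [j 0] ++ u) x) (dropFirst 1 j) := by
        refine measurable_proj_of_mem h hα hα1 hT fun k hk => ?_
        have := congrArg List.length hk
        simp [length_curtail] at this
      have hind := indepFun_of_sigmaOn h (S := {w ++ [j 0]}) (S' := {u | u ≠ w ++ [j 0]})
        (Set.disjoint_left.2 fun u hu hu' => hu' hu) hX hZ
      have hK' : P.map (ω (w ++ [j 0])) ≤ (K : ℝ≥0∞) • volume + κ := by
        rw [(h.ident (w ++ [j 0]) []).map_eq]
        exact hK
      refine (measure_add_map_mem_le (h.meas _) (hZ.mono (sigmaOn_le h _) le_rfl) hind hηtop hκ hK'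
        (hdet (j 0)) (fun A hA => ih (w ++ [j 0]) (dropFirst 1 j) A hA) hA).trans ?_
      rw [pow_succ']
      gcongr
      calc (K : ℝ≥0∞) + η * d * (2 * K) ≤ K + 2⁻¹ * (2 * K) := by gcongr
        _ = 2 * K := by
          rw [← mul_assoc, ENNReal.inv_mul_cancel (by simp) (by simp), one_mul, two_mul]
  refine ⟨2 * K, fun w j A hA => ?_⟩
  have hlim : Tendsto (fun n : ℕ => (2 * K : ℝ≥0∞) * volume A + η ^ n) atTop
      (𝓝 ((2 * K : ℝ≥0∞) * volume A + 0)) :=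
    (ENNReal.tendsto_pow_atTop_nhds_zero_of_lt_one
      (hηtwo.trans_lt (by simp))).const_add _
  have := ge_of_tendsto' hlim fun n => key n w j A hA
  push_cast
  simpa using this

/-! ### Expected moment sums -/

theorem mem_wordCylinder_of_isPrefix_curtail {m : ℕ} {v : List (Fin m)} {j : CodeSpace m} {k : ℕ}
    (h : v <+: curtail j k) : j ∈ wordCylinder v := by
  obtain ⟨l, rfl⟩ : ∃ l, k = v.length + l := by
    have := h.length_le
    rw [length_curtail] at this
    exact ⟨k - v.length, by omega⟩
  obtain ⟨t, ht⟩ := h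
  rw [curtail_add] at ht
  exact (List.append_inj ht (length_curtail _ _).symm).1.symm

theorem norm_sub_le_of_mem_meshCube {N : ℕ} {r : ℝ} (hr : 0 < r) {l : Fin N → ℤ} {x y : Esp N}
    (hx : x ∈ meshCube r l) (hy : y ∈ meshCube r l) : ‖x - y‖ ≤ N * r := by
  refine abs_le_of_sq_le_sq' ?_ (by positivity) |>.2
  rw [EuclideanSpace.norm_sq_eq]
  calc ∑ i, ‖(x - y) i‖ ^ 2 ≤ ∑ i : Fin N, r ^ 2 := by
        refine Finset.sum_le_sum fun i _ => ?_
        gcongr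
        obtain ⟨h1, h2⟩ := hx i
        obtain ⟨h3, h4⟩ := hy i
        rw [PiLp.sub_apply, Real.norm_eq_abs, abs_le]
        constructor <;> linarith
    _ = N * r ^ 2 := by simp
    _ ≤ (N * r) ^ 2 := by
        rw [mul_pow]
        gcongr
        have : N ≤ N ^ 2 := Nat.le_self_pow (by norm_num) N
        exact_mod_cast this

section Expectation

variable {m N : ℕ} {Ω : Type*} [MeasurableSpace Ω] {P : Measure Ω}
  {ω : List (Fin m) → Ω → Esp N} {R : ℝ} {T : Fin m → Esp N →L[ℝ] Esp N} {α : ℝ}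

/-- The points whose affine image lies in the cube form a set of volume at most a constant times `r
^ s / φ^s`, and the random point has bounded density. Uniformity in the shift `a` allows
conditioning on the displacements along `w`. -/
theorem exists_hit_bound [IsProbabilityMeasure P] (hN : 0 < N) (h : IsBoundedIID P ω R)
    (hTinj : ∀ i, Function.Injective (T i))
    (hα : 0 < α) (hα1 : α < 1) (hT : ∀ i, ‖T i‖ ≤ α) {s : ℝ≥0} (hs : (s : ℝ) ≤ N) :
    ∃ c : ℝ, 0 < c ∧ ∀ (w : List (Fin m)) (j : CodeSpace m) (r : ℝ), 0 < r →
      ∀ (l : Fin N → ℤ) (a : Esp N),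
        P {x | a + wordMap T w (proj T (fun u => ω (w ++ u) x) j) ∈ meshCube r l} ≤
          ENNReal.ofReal (c * (r ^ (s : ℝ) / singularValueFunction s (wordMap T w))) := by
  obtain ⟨K, hK⟩ := exists_density_bound h hTinj hα hα1 hT
  set R' : ℝ := max 1 (R * (1 - α)⁻¹) with hR'
  have hR1 : 1 ≤ R' := le_max_left _ _
  refine ⟨(K + 1) * ((4 * R') ^ N * (N : ℝ) ^ (s : ℝ)), by positivity, fun w j r hr l a => ?_⟩
  set A : Set (Esp N) :=
    Metric.closedBall 0 R' ∩ (fun z => a + wordMap T w z) ⁻¹' meshCube r l with hA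
  have hAm : MeasurableSet A := Metric.isClosed_closedBall.measurableSet.inter
    (((wordMap T w).measurable.const_add a) (measurableSet_meshCube r l))
  have hvol := volume_le_of_norm_image_le hN hs (wordMap_injective hTinj w) hR1
    (r := N * r) (by positivity) (A := A) (fun z hz => by simpa using hz.1)
    (fun z hz z' hz' => by
      have := norm_sub_le_of_mem_meshCube hr hz.2 hz'.2
      rwa [add_sub_add_left_eq_sub, ← map_sub] at this)
  have hφ := singularValueFunction_pos hN s (wordMap_injective hTinj w)
  calc P {x | a + wordMap T w (proj T (fun u => ω (w ++ u) x) j) ∈ meshCube r l}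
      ≤ P ((fun x => proj T (fun u => ω (w ++ u) x) j) ⁻¹' A) := by
        refine measure_mono fun x hx => ⟨?_, hx⟩
        rw [mem_closedBall_zero_iff]
        exact (norm_proj_le hα hα1 hT (fun u => h.bound _ x) j).trans (le_max_right _ _)
    _ ≤ K * volume A := hK w j A hAm
    _ ≤ ENNReal.ofReal (K + 1) * ENNReal.ofReal ((4 * R') ^ N *
          ((N * r) ^ (s : ℝ) / singularValueFunction s (wordMap T w))) := by
        gcongr
        rw [← ENNReal.ofReal_coe_nnreal]
        exact ENNReal.ofReal_le_ofReal (by linarith)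
    _ = _ := by
        rw [← ENNReal.ofReal_mul (by positivity), Real.mul_rpow (by positivity) hr.le]
        congr 1
        ring

/-- A cube is hit below `w ++ [b]` with small probability, given all displacements of words that do
not extend `w ++ [b]`. -/
theorem lintegral_mul_measure_cylinder_le [IsProbabilityMeasure P] (h : IsBoundedIID P ω R)
    (hα : 0 < α) (hα1 : α < 1) (hT : ∀ i, ‖T i‖ ≤ α) (μ : Measure (CodeSpace m))
    [IsFiniteMeasure μ] {w : List (Fin m)} {b : Fin m} {C : Set (Esp N)} (hC : MeasurableSet C)
    {c : ℝ≥0∞}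
    (hc : ∀ j a, P {x | a + wordMap T w (proj T (fun u => ω (w ++ u) x) j) ∈ C} ≤ c)
    {g : Ω → ℝ≥0∞} (hg : Measurable[sigmaOn ω {u | ¬ w ++ [b] <+: u}] g) :
    ∫⁻ x, g x * μ (wordCylinder (w ++ [b]) ∩ proj T (fun u => ω u x) ⁻¹' C) ∂P ≤
      c * μ (wordCylinder (w ++ [b])) * ∫⁻ x, g x ∂P := by
  have hgm : Measurable g := hg.mono (sigmaOn_le h _) le_rfl
  have hpm := measurable_proj hα hα1 hT h.bound h.meas
  have hjoint : Measurable fun p : Ω × CodeSpace m =>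
      g p.1 * C.indicator 1 (proj T (fun u => ω u p.1) p.2) :=
    (hgm.comp measurable_fst).mul ((measurable_one.indicator hC).comp hpm)
  have hpx : ∀ x, Measurable (proj T fun u => ω u x) := fun x =>
    measurable_proj_apply hα hα1 hT fun u => h.bound u x
  have h1 : ∀ x, g x * μ (wordCylinder (w ++ [b]) ∩ proj T (fun u => ω u x) ⁻¹' C) =
      ∫⁻ j in wordCylinder (w ++ [b]), g x * C.indicator 1 (proj T (fun u => ω u x) j) ∂μ := by
    intro x
    have hind : Measurable fun j => C.indicator (1 : Esp N → ℝ≥0∞) (proj T (fun u => ω u x) j) :=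
      (measurable_one.indicator hC).comp (hpx x)
    rw [lintegral_const_mul _ hind, Set.inter_comm,
      ← Measure.restrict_apply (hpx x hC), ← lintegral_indicator_one (hpx x hC)]
    rfl
  simp only [h1]
  -- Tonelli reduces the claim to a single word `j`, for which the conditional hitting bound
  -- applies.
  rw [lintegral_lintegral_swap hjoint.aemeasurable]
  have h2 : ∀ j ∈ wordCylinder (w ++ [b]),
      ∫⁻ x, g x * C.indicator 1 (proj T (fun u => ω u x) j) ∂P ≤ c * ∫⁻ x, g x ∂P := by
    intro j hj
    have hjw := (mem_wordCylinder_append.1 hj).1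
    have hcur : curtail j w.length = w := hjw
    -- `A` involves words of length at most `w.length`, none extending `w ++ [b]`; `Z` involves only
    -- extensions of `w ++ [b]`, since `j` continues `w` by `b`. So `Z` is independent of the pair
    -- `(g, A)`.
    set A : Ω → Esp N := fun x => ∑ l ∈ Finset.range w.length,
      wordMap T (curtail j l) (ω (curtail j (l + 1)) x) with hA
    set Z : Ω → Esp N := fun x =>
      proj T (fun u => ω (w ++ u) x) (dropFirst w.length j) with hZ
    have hdec : ∀ x, proj T (fun u => ω u x) j = A x + wordMap T w (Z x) := by
      intro x
      rw [proj_eq_sum_add hα hα1 hT (fun u => h.bound u x) j w.length, hcur]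
    have hAm : Measurable[sigmaOn ω {u | ¬ w ++ [b] <+: u}] A := by
      refine @Finset.measurable_fun_sum _ _ _ _ _ _ (sigmaOn ω {u | ¬ w ++ [b] <+: u}) _ _
        fun l hl => ?_
      refine (wordMap T (curtail j l)).measurable.comp (measurable_sigmaOn ω fun hpre => ?_)
      have := hpre.length_le
      rw [length_curtail] at this
      simp at this hl
      omega
    have hZm : Measurable[sigmaOn ω {u | w ++ [b] <+: u}] Z := by
      refine measurable_proj_of_mem h hα hα1 hT fun k => ?_
      have hj' : curtail j (w.length + 1) = w ++ [b] := by
        have : curtail j (w ++ [b]).length = w ++ [b] := hj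
        simpa using this
      refine ⟨curtail (dropFirst (w.length + 1) j) k, ?_⟩
      calc w ++ [b] ++ curtail (dropFirst (w.length + 1) j) k
          = curtail j (w.length + (k + 1)) := by
            rw [add_comm k 1, ← add_assoc, curtail_add, hj']
        _ = _ := by rw [curtail_add, hcur]
    have hgA : Measurable[sigmaOn ω {u | ¬ w ++ [b] <+: u}] fun x => (g x, A x) := hg.prodMk hAm
    have hind : IndepFun (fun x => (g x, A x)) Z P :=
      indepFun_of_sigmaOn h (S := {u | ¬ w ++ [b] <+: u}) (S' := {u | w ++ [b] <+: u})
        (Set.disjoint_left.2 fun u hu hu' => hu hu') hgA hZm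
    have hF : Measurable fun p : (ℝ≥0∞ × Esp N) × Esp N =>
        p.1.1 * C.indicator 1 (p.1.2 + wordMap T w p.2) :=
      (measurable_fst.comp measurable_fst).mul ((measurable_one.indicator hC).comp
        ((measurable_snd.comp measurable_fst).add ((wordMap T w).measurable.comp measurable_snd)))
    have hZm' : Measurable Z := hZm.mono (sigmaOn_le h _) le_rfl
    have h3 := lintegral_indepFun (hgA.mono (sigmaOn_le h _) le_rfl) hZm' hind hF
    simp only [hdec]
    rw [h3, ← lintegral_const_mul _ hgm]
    refine lintegral_mono fun x => ?_
    have hset : MeasurableSet {y | A x + wordMap T w (Z y) ∈ C} :=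
      (((wordMap T w).measurable.comp hZm').const_add (A x)) hC
    calc ∫⁻ y, g x * C.indicator 1 (A x + wordMap T w (Z y)) ∂P
        = g x * ∫⁻ y, {y | A x + wordMap T w (Z y) ∈ C}.indicator 1 y ∂P := by
          rw [← lintegral_const_mul _ (measurable_one.indicator hset)]
          rfl
      _ = g x * P {y | A x + wordMap T w (Z y) ∈ C} := by rw [lintegral_indicator_one hset]
      _ ≤ g x * c := by gcongr; exact hc _ _
      _ = c * g x := mul_comm _ _
  calc ∫⁻ j in wordCylinder (w ++ [b]),
        ∫⁻ x, g x * C.indicator 1 (proj T (fun u => ω u x) j) ∂P ∂μ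
      ≤ ∫⁻ j in wordCylinder (w ++ [b]), c * ∫⁻ x, g x ∂P ∂μ :=
        setLIntegral_mono' (measurableSet_wordCylinder _) h2
    _ = _ := by rw [setLIntegral_const]; ring

/-- The expected contribution of the cylinder of `w` to the moment sum. -/
def expectedMoment (P : Measure Ω) (ω : List (Fin m) → Ω → Esp N) (T : Fin m → Esp N →L[ℝ] Esp N)
    (μ : Measure (CodeSpace m)) (q r : ℝ) (w : List (Fin m)) : ℝ≥0∞ :=
  ∑' l : Fin N → ℤ,
    ∫⁻ x, μ (wordCylinder w ∩ proj T (fun u => ω u x) ⁻¹' meshCube r l) ^ q ∂P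

theorem measurable_measure_cylinder_meshCube (h : IsBoundedIID P ω R)
    (hα : 0 < α) (hα1 : α < 1) (hT : ∀ i, ‖T i‖ ≤ α) (μ : Measure (CodeSpace m))
    [IsFiniteMeasure μ] (w : List (Fin m)) (r : ℝ) (l : Fin N → ℤ) :
    Measurable fun x => μ (wordCylinder w ∩ proj T (fun u => ω u x) ⁻¹' meshCube r l) :=
  (measurable_measure_cylinder h hα hα1 hT μ (S := Set.univ) (fun _ _ _ => Set.mem_univ _)
    (measurableSet_meshCube r l)).mono (sigmaOn_le h _) le_rfl

theorem tsum_measure_cylinder_meshCube (μ : Measure (CodeSpace m)) {f : CodeSpace m → Esp N}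
    (hf : Measurable f) (w : List (Fin m)) {r : ℝ} (hr : 0 < r) :
    ∑' l : Fin N → ℤ, μ (wordCylinder w ∩ f ⁻¹' meshCube r l) = μ (wordCylinder w) := by
  have := tsum_measure_meshCube ((μ.restrict (wordCylinder w)).map f) hr
  rw [Measure.map_apply hf MeasurableSet.univ] at this
  simpa [Measure.map_apply hf (measurableSet_meshCube r _),
    Measure.restrict_apply (hf (measurableSet_meshCube r _)), Set.inter_comm] using this

theorem expectedMoment_le [IsProbabilityMeasure P] (h : IsBoundedIID P ω R)
    (hα : 0 < α) (hα1 : α < 1) (hT : ∀ i, ‖T i‖ ≤ α) (μ : Measure (CodeSpace m))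
    [IsFiniteMeasure μ] {q : ℝ} (hq : 1 ≤ q) {r : ℝ} (hr : 0 < r) (w : List (Fin m)) :
    expectedMoment P ω T μ q r w ≤ μ (wordCylinder w) ^ q := by
  rw [expectedMoment, ← lintegral_tsum fun l =>
    ((measurable_measure_cylinder_meshCube h hα hα1 hT μ w r l).pow_const q).aemeasurable]
  calc _ ≤ ∫⁻ x, μ (wordCylinder w) ^ q ∂P := by
        refine lintegral_mono fun x => (tsum_rpow_le_rpow_tsum _ hq).trans (le_of_eq ?_)
        rw [tsum_measure_cylinder_meshCube μ 
          (measurable_proj_apply hα hα1 hT fun u => h.bound u x) w hr]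
    _ = _ := by simp

/-- The recursive estimate for the expected moments along the tree of words. -/
theorem exists_expectedMoment_le_sum [IsProbabilityMeasure P] (hN : 0 < N)
    (h : IsBoundedIID P ω R) (hTinj : ∀ i, Function.Injective (T i))
    (hα : 0 < α) (hα1 : α < 1) (hT : ∀ i, ‖T i‖ ≤ α) (μ : Measure (CodeSpace m))
    [IsFiniteMeasure μ] {q : ℝ} (hq : 1 < q) {s : ℝ≥0} (hs : (s : ℝ) ≤ N) {δ : ℝ≥0}
    (hδ : 0 < δ) :
    ∃ C : ℝ≥0∞, C ≠ ∞ ∧ ∀ r : ℝ, 0 < r → ∀ w : List (Fin m),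
      expectedMoment P ω T μ q r w ≤
        (1 + δ * (1 + m)) * ∑ a, expectedMoment P ω T μ q r (w ++ [a]) +
          C * ENNReal.ofReal (r ^ (s : ℝ)) ^ (q - 1) *
            (ENNReal.ofReal (singularValueFunction s (wordMap T w)) ^ (1 - q) *
              μ (wordCylinder w) ^ q) := by
  obtain ⟨C, hC⟩ := exists_ennreal_sum_rpow_le m hq hδ
  obtain ⟨c, hc, hhit⟩ := exists_hit_bound hN h hTinj hα hα1 hT hs
  refine ⟨C * ENNReal.ofReal c ^ (q - 1), ENNReal.mul_ne_top (by simp)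
    (ENNReal.rpow_ne_top_of_nonneg (by linarith) (by simp)), fun r hr w => ?_⟩
  have hφ := singularValueFunction_pos hN s (wordMap_injective hTinj w)
  set φ := singularValueFunction s (wordMap T w) with hφdef
  -- A null cylinder is treated apart because `z`, by which the cross terms are divided, would be
  -- zero.
  rcases eq_or_ne (μ (wordCylinder w)) 0 with hμ | hμ
  · refine (expectedMoment_le h hα hα1 hT μ hq.le hr w).trans ?_
    rw [hμ, ENNReal.zero_rpow_of_pos (by linarith)]
    exact zero_le
  set p : ℝ≥0∞ := ENNReal.ofReal (c * (r ^ (s : ℝ) / φ)) with hp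
  have hp0 : p ≠ 0 := by
    rw [hp, Ne, ENNReal.ofReal_eq_zero, not_le]
    positivity
  -- This `z` bounds the conditional expectation of each sibling mass `Y (w ++ [b])`. Hence each
  -- cross term is at most `E[Y_a ^ q]` after division by `z`, and `z ^ (q - 1) * μ(C_w)` has the
  -- form of a term of the moment series.
  set z : ℝ≥0∞ := p * μ (wordCylinder w) with hz
  have hz0 : z ≠ 0 := mul_ne_zero hp0 hμ
  have hztop : z ≠ ∞ := ENNReal.mul_ne_top (by simp [hp]) (measure_ne_top _ _)
  set Y : List (Fin m) → (Fin N → ℤ) → Ω → ℝ≥0∞ := fun v l x =>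
    μ (wordCylinder v ∩ proj T (fun u => ω u x) ⁻¹' meshCube r l) with hY
  have hYm : ∀ v l, Measurable (Y v l) := fun v l =>
    measurable_measure_cylinder_meshCube h hα hα1 hT μ v r l
  have hYq : ∀ v l, Measurable fun x => Y v l x ^ q := fun v l => (hYm v l).pow_const q
  have hcross : ∀ a b, b ≠ a → ∀ l,
      ∫⁻ x, Y (w ++ [a]) l x ^ q * Y (w ++ [b]) l x / z ∂P ≤ ∫⁻ x, Y (w ++ [a]) l x ^ q ∂P := by
    intro a b hab l
    have hg : Measurable[sigmaOn ω {u | ¬ w ++ [b] <+: u}] fun x => Y (w ++ [a]) l x ^ q := by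
      refine (measurable_measure_cylinder h hα hα1 hT μ (S := {u | ¬ w ++ [b] <+: u})
        (v := w ++ [a]) (fun j hj k (hpre : w ++ [b] <+: _) => hab ?_)
        (measurableSet_meshCube r l)).pow_const q
      exact (mem_wordCylinder_append.1 (mem_wordCylinder_of_isPrefix_curtail hpre)).2.symm.trans
        (mem_wordCylinder_append.1 hj).2
    have h1 := lintegral_mul_measure_cylinder_le h hα hα1 hT μ (measurableSet_meshCube r l)
      (fun j a => hhit w j r hr l a) hg
    have hprod : Measurable fun x => Y (w ++ [a]) l x ^ q * Y (w ++ [b]) l x :=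
      (hYq _ l).mul (hYm _ l)
    simp only [div_eq_mul_inv]
    rw [lintegral_mul_const _ hprod, ← div_eq_mul_inv,
      ENNReal.div_le_iff hz0 hztop, mul_comm]
    refine h1.trans ?_
    rw [hz]
    gcongr
    exact fun j hj => (mem_wordCylinder_append.1 hj).1
  have hsingle : ∀ l, ∫⁻ x, Y w l x ^ q ∂P ≤
      (1 + δ * (1 + m)) * ∑ a, ∫⁻ x, Y (w ++ [a]) l x ^ q ∂P +
        C * z ^ (q - 1) * ∑ a, ∫⁻ x, Y (w ++ [a]) l x ∂P := by
    intro l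
    calc ∫⁻ x, Y w l x ^ q ∂P
        ≤ ∫⁻ x, ((1 + δ) * ∑ a, Y (w ++ [a]) l x ^ q + δ * ∑ a, ∑ b ∈ Finset.univ.erase a,
            Y (w ++ [a]) l x ^ q * Y (w ++ [b]) l x / z +
            C * z ^ (q - 1) * ∑ a, Y (w ++ [a]) l x) ∂P := by
          refine lintegral_mono fun x => ?_
          have : Y w l x = ∑ a, Y (w ++ [a]) l x := measure_wordCylinder_inter μ w _
          rw [this]
          exact hC z hz0 hztop _ fun a => measure_ne_top _ _
      _ = (1 + δ) * ∑ a, ∫⁻ x, Y (w ++ [a]) l x ^ q ∂P + δ * ∑ a, ∑ b ∈ Finset.univ.erase a,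
            ∫⁻ x, Y (w ++ [a]) l x ^ q * Y (w ++ [b]) l x / z ∂P +
            C * z ^ (q - 1) * ∑ a, ∫⁻ x, Y (w ++ [a]) l x ∂P := by
          have m1 : Measurable fun x => ∑ a, Y (w ++ [a]) l x ^ q :=
            Finset.measurable_fun_sum _ fun a _ => hYq _ l
          have m2 : ∀ a b, Measurable fun x => Y (w ++ [a]) l x ^ q * Y (w ++ [b]) l x / z :=
            fun a b => ((hYq _ l).mul (hYm _ l)).div_const z
          have m3 : ∀ a, Measurable fun x => ∑ b ∈ Finset.univ.erase a,
              Y (w ++ [a]) l x ^ q * Y (w ++ [b]) l x / z := fun a =>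
            Finset.measurable_fun_sum _ fun b _ => m2 a b
          have m4 : Measurable fun x => ∑ a, ∑ b ∈ Finset.univ.erase a,
              Y (w ++ [a]) l x ^ q * Y (w ++ [b]) l x / z :=
            Finset.measurable_fun_sum _ fun a _ => m3 a
          have m5 : Measurable fun x => ∑ a, Y (w ++ [a]) l x :=
            Finset.measurable_fun_sum _ fun a _ => hYm _ l
          rw [lintegral_add_right _ (m5.const_mul _), lintegral_add_right _ (m4.const_mul _),
            lintegral_const_mul _ m1, lintegral_const_mul _ m4, lintegral_const_mul _ m5,
            lintegral_finsetSum _ fun a _ => hYq _ l, lintegral_finsetSum _ fun a _ => m3 a,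
            lintegral_finsetSum _ fun a _ => hYm _ l]
          congr 3
          refine Finset.sum_congr rfl fun a _ => ?_
          rw [lintegral_finsetSum _ fun b _ => m2 a b]
      _ ≤ (1 + δ) * ∑ a, ∫⁻ x, Y (w ++ [a]) l x ^ q ∂P +
            δ * ∑ a, m * ∫⁻ x, Y (w ++ [a]) l x ^ q ∂P +
            C * z ^ (q - 1) * ∑ a, ∫⁻ x, Y (w ++ [a]) l x ∂P := by
          gcongr with a
          calc _ ≤ ∑ b ∈ Finset.univ.erase a, ∫⁻ x, Y (w ++ [a]) l x ^ q ∂P :=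
                Finset.sum_le_sum fun b hb => hcross a b (Finset.ne_of_mem_erase hb) l
            _ ≤ ∑ b : Fin m, ∫⁻ x, Y (w ++ [a]) l x ^ q ∂P :=
                Finset.sum_le_sum_of_subset (Finset.erase_subset _ _)
            _ = _ := by simp
      _ = _ := by
          rw [← Finset.mul_sum]
          ring
  have hfirst : ∑' l, ∑ a, ∫⁻ x, Y (w ++ [a]) l x ∂P = μ (wordCylinder w) := by
    rw [measure_wordCylinder μ w, Summable.tsum_finsetSum fun a _ => ENNReal.summable]
    refine Finset.sum_congr rfl fun a _ => ?_
    rw [← lintegral_tsum fun l => (hYm _ l).aemeasurable]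
    calc _ = ∫⁻ x, μ (wordCylinder (w ++ [a])) ∂P := lintegral_congr fun x =>
          tsum_measure_cylinder_meshCube μ
            (measurable_proj_apply hα hα1 hT fun u => h.bound u x) _ hr
      _ = _ := by simp
  calc expectedMoment P ω T μ q r w
      ≤ ∑' l, ((1 + δ * (1 + m)) * ∑ a, ∫⁻ x, Y (w ++ [a]) l x ^ q ∂P +
        C * z ^ (q - 1) * ∑ a, ∫⁻ x, Y (w ++ [a]) l x ∂P) := ENNReal.tsum_le_tsum hsingle
    _ = (1 + δ * (1 + m)) * ∑ a, expectedMoment P ω T μ q r (w ++ [a]) +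
          C * z ^ (q - 1) * μ (wordCylinder w) := by
        rw [ENNReal.tsum_add, ENNReal.tsum_mul_left, ENNReal.tsum_mul_left, hfirst,
          Summable.tsum_finsetSum fun a _ => ENNReal.summable]
        rfl
    _ = _ := by
        congr 1
        have e1 : ∀ y : ℝ≥0∞, y ^ (q - 1) * y = y ^ q := fun y => by
          conv_lhs => rw [← ENNReal.rpow_one y]
          rw [← ENNReal.rpow_mul, ← ENNReal.rpow_add_of_nonneg _ _ (by linarith) zero_le_one]
          simp
        have e2 : p = ENNReal.ofReal c * (ENNReal.ofReal (r ^ (s : ℝ)) * (ENNReal.ofReal φ)⁻¹) := by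
          rw [hp, ENNReal.ofReal_mul hc.le, ENNReal.ofReal_div_of_pos hφ, div_eq_mul_inv]
        rw [hz, e2, ENNReal.mul_rpow_of_nonneg _ _ (by linarith : 0 ≤ q - 1),
          ENNReal.mul_rpow_of_nonneg _ _ (by linarith : 0 ≤ q - 1),
          ENNReal.mul_rpow_of_nonneg _ _ (by linarith : 0 ≤ q - 1), ENNReal.inv_rpow,
          ← ENNReal.rpow_neg, neg_sub, ← e1 (μ (wordCylinder w))]
        ring

end Expectation

/-! ### The lower bound -/

/-- Iteration of a recursive estimate along the tree of words. -/
theorem le_sum_of_recursion {m : ℕ} {Q B : List (Fin m) → ℝ≥0∞} {c : ℝ≥0∞}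
    (h : ∀ w, Q w ≤ c * ∑ a, Q (w ++ [a]) + B w) (n : ℕ) :
    Q [] ≤ ∑ k ∈ Finset.range n, c ^ k * ∑ i : Fin k → Fin m, B (List.ofFn i) +
      c ^ n * ∑ i : Fin n → Fin m, Q (List.ofFn i) := by
  induction n with
  | zero => simp
  | succ n ih =>
    refine ih.trans ?_
    rw [Finset.sum_range_succ, sum_ofFn_succ Q, add_assoc]
    gcongr
    calc c ^ n * ∑ i : Fin n → Fin m, Q (List.ofFn i)
        ≤ c ^ n * ∑ i : Fin n → Fin m, (c * ∑ a, Q (List.ofFn i ++ [a]) + B (List.ofFn i)) := by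
          gcongr
          exact h _
      _ = _ := by
          rw [Finset.sum_add_distrib, ← Finset.mul_sum]
          ring

section LowerBound

variable {m N : ℕ} {Ω : Type*} [MeasurableSpace Ω] {P : Measure Ω}
  {ω : List (Fin m) → Ω → Esp N} {R : ℝ} {T : Fin m → Esp N →L[ℝ] Esp N} {α : ℝ}

theorem momentSum_projMeasure (hα : 0 < α) (hα1 : α < 1) (hT : ∀ i, ‖T i‖ ≤ α)
    (μ : Measure (CodeSpace m)) {ω : List (Fin m) → Esp N} (hω : ∀ w, ‖ω w‖ ≤ R) (q r : ℝ) :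
    momentSum (projMeasure T μ ω) q r =
      ∑' l : Fin N → ℤ, μ (wordCylinder [] ∩ proj T ω ⁻¹' meshCube r l) ^ q := by
  refine tsum_congr fun l => ?_
  rw [projMeasure, Measure.map_apply (measurable_proj_apply hα hα1 hT hω)
    (measurableSet_meshCube r l), wordCylinder_nil, Set.univ_inter]

theorem measurable_momentSum (h : IsBoundedIID P ω R) (hα : 0 < α) (hα1 : α < 1)
    (hT : ∀ i, ‖T i‖ ≤ α) (μ : Measure (CodeSpace m)) [IsFiniteMeasure μ] (q r : ℝ) :
    Measurable fun x => momentSum (projMeasure T μ fun w => ω w x) q r := by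
  simp only [fun x => momentSum_projMeasure hα hα1 hT μ (fun w => h.bound w x) q r]
  exact Measurable.tsum fun l =>
    (measurable_measure_cylinder_meshCube h hα hα1 hT μ [] r l).pow_const q

theorem lintegral_momentSum (h : IsBoundedIID P ω R) (hα : 0 < α) (hα1 : α < 1)
    (hT : ∀ i, ‖T i‖ ≤ α) (μ : Measure (CodeSpace m)) [IsFiniteMeasure μ] (q r : ℝ) :
    ∫⁻ x, momentSum (projMeasure T μ fun w => ω w x) q r ∂P = expectedMoment P ω T μ q r [] := by
  simp only [fun x => momentSum_projMeasure hα hα1 hT μ (fun w => h.bound w x) q r]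
  rw [expectedMoment, lintegral_tsum fun l =>
    ((measurable_measure_cylinder_meshCube h hα hα1 hT μ [] r l).pow_const q).aemeasurable]

/-- The terms of the moment series at exponents `s < t` differ by a geometric factor. -/
theorem pow_mul_rpow_le (hN : 0 < N) (hTinj : ∀ i, Function.Injective (T i))
    (hα : 0 < α) (hT : ∀ i, ‖T i‖ ≤ α) {q : ℝ} (hq : 1 < q) {s t : ℝ≥0} (hs : (s : ℝ) ≤ N)
    (hst : s ≤ t) {c : ℝ≥0∞} (hc : c ≤ ENNReal.ofReal (α ^ ((t : ℝ) - s)) ^ (1 - q))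
    (w : List (Fin m)) :
    c ^ w.length * ENNReal.ofReal (singularValueFunction s (wordMap T w)) ^ (1 - q) ≤
      ENNReal.ofReal (singularValueFunction t (wordMap T w)) ^ (1 - q) := by
  have hinj := wordMap_injective hTinj w
  have hφ := singularValueFunction_pos hN s hinj
  have hts : 0 ≤ (t : ℝ) - s := sub_nonneg.2 (by exact_mod_cast hst)
  have hle : singularValueFunction t (wordMap T w) ≤
      singularValueFunction s (wordMap T w) * (α ^ ((t : ℝ) - s)) ^ w.length := by
    refine (singularValueFunction_le_mul hN hs hst hinj).trans ?_
    gcongr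
    calc ‖wordMap T w‖ ^ ((t : ℝ) - s) ≤ (α ^ w.length) ^ ((t : ℝ) - s) := by
          gcongr
          exact norm_wordMap_le hα hT w
      _ = _ := by
          rw [← Real.rpow_natCast, ← Real.rpow_natCast, ← Real.rpow_mul hα.le,
            ← Real.rpow_mul hα.le, mul_comm]
  have hpos : 0 < α ^ ((t : ℝ) - s) := Real.rpow_pos_of_pos hα _
  calc c ^ w.length * ENNReal.ofReal (singularValueFunction s (wordMap T w)) ^ (1 - q)
      ≤ (ENNReal.ofReal (α ^ ((t : ℝ) - s)) ^ (1 - q)) ^ w.length *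
          ENNReal.ofReal (singularValueFunction s (wordMap T w)) ^ (1 - q) := by gcongr
    _ = ENNReal.ofReal (singularValueFunction s (wordMap T w) *
          (α ^ ((t : ℝ) - s)) ^ w.length) ^ (1 - q) := by
        rw [ENNReal.ofReal_mul hφ.le, ENNReal.mul_rpow_of_ne_top (by simp) (by simp),
          ENNReal.ofReal_pow hpos.le, ← ENNReal.rpow_natCast, ← ENNReal.rpow_natCast,
          ← ENNReal.rpow_mul, ← ENNReal.rpow_mul, mul_comm (1 - q), mul_comm]
    _ ≤ _ := by
        rw [← neg_sub q 1, ENNReal.rpow_neg, ENNReal.rpow_neg]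
        gcongr

/-- Expected moment sums are controlled by the moment series at a larger exponent. -/
theorem exists_lintegral_momentSum_le [IsProbabilityMeasure P] (hN : 0 < N)
    (h : IsBoundedIID P ω R) (hTinj : ∀ i, Function.Injective (T i))
    (hα : 0 < α) (hα1 : α < 1) (hT : ∀ i, ‖T i‖ ≤ α) (μ : Measure (CodeSpace m))
    [IsFiniteMeasure μ] {q : ℝ} (hq : 1 < q) {s t : ℝ≥0} (hs : (s : ℝ) ≤ N) (hst : s < t)
    (ht : momentSeries T μ q t < ∞) :
    ∃ A : ℝ≥0∞, A ≠ ∞ ∧ ∀ r : ℝ, 0 < r →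
      ∫⁻ x, momentSum (projMeasure T μ fun w => ω w x) q r ∂P ≤
        A * ENNReal.ofReal (r ^ (s : ℝ)) ^ (q - 1) := by
  have hts : 0 < (t : ℝ) - s := sub_pos.2 (by exact_mod_cast hst)
  have hb0 : 0 < α ^ ((t : ℝ) - s) := Real.rpow_pos_of_pos hα _
  have hb1 : α ^ ((t : ℝ) - s) < 1 := Real.rpow_lt_one hα.le hα1 hts
  have hb : 1 < (α ^ ((t : ℝ) - s)) ^ (1 - q) :=
    Real.one_lt_rpow_of_pos_of_lt_one_of_neg hb0 hb1 (by linarith)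
  set b : ℝ := (α ^ ((t : ℝ) - s)) ^ (1 - q) with hbdef
  have hδ' : 0 < (b - 1) / (1 + m) := div_pos (by linarith) (by positivity)
  -- Chosen so that the recursion factor `1 + δ * (1 + m)` is exactly the factor per letter gained
  -- in the moment series when `s` is replaced by `t`.
  set δ : ℝ≥0 := ⟨(b - 1) / (1 + m), hδ'.le⟩ with hδdef
  have hδ : 0 < δ := hδ'
  have hc : (1 + δ * (1 + m) : ℝ≥0∞) = ENNReal.ofReal (α ^ ((t : ℝ) - s)) ^ (1 - q) := by
    rw [ENNReal.ofReal_rpow_of_pos hb0, ← hbdef]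
    have h1 : (1 + δ * (1 + m) : ℝ≥0∞) = ((1 + δ * (1 + m) : ℝ≥0) : ℝ≥0∞) := by push_cast; rfl
    rw [h1, ← ENNReal.ofReal_coe_nnreal]
    congr 1
    push_cast
    rw [hδdef]
    change 1 + (b - 1) / (1 + m) * (1 + m) = b
    field_simp
    ring
  obtain ⟨C, hC, hrec⟩ := exists_expectedMoment_le_sum hN h hTinj hα hα1 hT μ hq hs hδ
  refine ⟨C * momentSeries T μ q t + momentSeries T μ q t,
    ENNReal.add_ne_top.2 ⟨ENNReal.mul_ne_top hC ht.ne, ht.ne⟩, fun r hr => ?_⟩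
  rw [lintegral_momentSum h hα hα1 hT μ q r]
  set ρ : ℝ≥0∞ := ENNReal.ofReal (r ^ (s : ℝ)) ^ (q - 1) with hρ
  set c : ℝ≥0∞ := 1 + δ * (1 + m) with hcdef
  have hlevel : ∀ k, c ^ k * ∑ i : Fin k → Fin m,
      ENNReal.ofReal (singularValueFunction s (wordMap T (List.ofFn i))) ^ (1 - q) *
        μ (wordCylinder (List.ofFn i)) ^ q ≤ ∑ i : Fin k → Fin m,
      ENNReal.ofReal (singularValueFunction t (wordMap T (List.ofFn i))) ^ (1 - q) *
        μ (wordCylinder (List.ofFn i)) ^ q := by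
    intro k
    rw [Finset.mul_sum]
    refine Finset.sum_le_sum fun i _ => ?_
    have := pow_mul_rpow_le hN hTinj hα hT hq hs hst.le hc.le (List.ofFn i)
    rw [List.length_ofFn] at this
    rw [← mul_assoc]
    gcongr
  -- The recursion is stopped once `α ^ n < r`. There `φ^s ≤ r ^ s`, so the trivial bound `μ(C_w) ^
  -- q` is already dominated by `ρ` times a term of the series.
  obtain ⟨n, hn⟩ := exists_pow_lt_of_lt_one hr hα1
  have htail : ∀ i : Fin n → Fin m, expectedMoment P ω T μ q r (List.ofFn i) ≤
      ρ * (ENNReal.ofReal (singularValueFunction s (wordMap T (List.ofFn i))) ^ (1 - q) *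
        μ (wordCylinder (List.ofFn i)) ^ q) := by
    intro i
    refine (expectedMoment_le h hα hα1 hT μ hq.le hr _).trans ?_
    have hinj := wordMap_injective hTinj (List.ofFn i)
    have hφ := singularValueFunction_pos hN s hinj
    have hφr : singularValueFunction s (wordMap T (List.ofFn i)) ≤ r ^ (s : ℝ) := by
      refine (singularValueFunction_le_norm_rpow hN s hinj).trans ?_
      gcongr
      have := norm_wordMap_le hα hT (List.ofFn i)
      rw [List.length_ofFn] at this
      exact this.trans hn.le
    rw [← mul_assoc]
    refine le_mul_of_one_le_left zero_le ?_
    calc (1 : ℝ≥0∞) = ENNReal.ofReal (singularValueFunction s (wordMap T (List.ofFn i))) ^ (q - 1) *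
          ENNReal.ofReal (singularValueFunction s (wordMap T (List.ofFn i))) ^ (1 - q) := by
          rw [← ENNReal.rpow_add _ _ (by simpa using hφ) (by simp)]
          simp
      _ ≤ _ := by
          rw [hρ]
          gcongr
  refine (le_sum_of_recursion (fun w => hrec r hr w) n).trans ?_
  rw [add_mul]
  gcongr ?_ + ?_
  · calc _ = ∑ k ∈ Finset.range n, C * ρ * (c ^ k * ∑ i : Fin k → Fin m,
            ENNReal.ofReal (singularValueFunction s (wordMap T (List.ofFn i))) ^ (1 - q) *
              μ (wordCylinder (List.ofFn i)) ^ q) := by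
          refine Finset.sum_congr rfl fun k _ => ?_
          rw [← Finset.mul_sum]
          ring
      _ ≤ C * ρ * ∑ k ∈ Finset.range n, ∑ i : Fin k → Fin m,
            ENNReal.ofReal (singularValueFunction t (wordMap T (List.ofFn i))) ^ (1 - q) *
              μ (wordCylinder (List.ofFn i)) ^ q := by
          rw [← Finset.mul_sum]
          gcongr
          exact hlevel _
      _ ≤ C * ρ * momentSeries T μ q t := by
          gcongr
          exact ENNReal.sum_le_tsum (f := fun k => ∑ i : Fin k → Fin m,
            ENNReal.ofReal (singularValueFunction t (wordMap T (List.ofFn i))) ^ (1 - q) *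
              μ (wordCylinder (List.ofFn i)) ^ q) _
      _ = _ := by ring
  · calc _ ≤ c ^ n * ∑ i : Fin n → Fin m, ρ *
            (ENNReal.ofReal (singularValueFunction s (wordMap T (List.ofFn i))) ^ (1 - q) *
              μ (wordCylinder (List.ofFn i)) ^ q) := by
          gcongr
          exact htail _
      _ = ρ * (c ^ n * ∑ i : Fin n → Fin m,
            ENNReal.ofReal (singularValueFunction s (wordMap T (List.ofFn i))) ^ (1 - q) *
              μ (wordCylinder (List.ofFn i)) ^ q) := by
          rw [← Finset.mul_sum]; ring
      _ ≤ ρ * momentSeries T μ q t := by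
          gcongr
          refine (hlevel n).trans ?_
          exact ENNReal.le_tsum (f := fun k => ∑ i : Fin k → Fin m,
            ENNReal.ofReal (singularValueFunction t (wordMap T (List.ofFn i))) ^ (1 - q) *
              μ (wordCylinder (List.ofFn i)) ^ q) n
      _ = _ := mul_comm _ _

theorem ae_le_lowerDim [IsProbabilityMeasure P] (hN : 0 < N)
    (h : IsBoundedIID P ω R) (hTinj : ∀ i, Function.Injective (T i))
    (hα : 0 < α) (hα1 : α < 1) (hT : ∀ i, ‖T i‖ ≤ α) (μ : Measure (CodeSpace m))
    [IsFiniteMeasure μ] {q : ℝ} (hq : 1 < q) {s : ℝ≥0}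
    (hs : (s : ℝ≥0∞) < min (dqLower T μ q) N) :
    ∀ᵐ x ∂P, ((s : ℝ) : EReal) ≤ lowerDim (projMeasure T μ fun w => ω w x) q := by
  obtain ⟨hs1, hs2⟩ := lt_min_iff.1 hs
  simp only [dqLower, lt_iSup_iff] at hs1
  obtain ⟨t, ht, hst⟩ := hs1
  have hst : s < t := by exact_mod_cast hst
  have hsN : s < (N : ℝ≥0) := by exact_mod_cast hs2
  -- The gap `u < t` is used by the expectation bound; the gap `s < u` makes the sum over dyadic
  -- scales converge.
  obtain ⟨u, hsu, hu⟩ := exists_between (lt_min hst hsN)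
  obtain ⟨hut, huN⟩ := lt_min_iff.1 hu
  obtain ⟨A, hA, hbound⟩ := exists_lintegral_momentSum_le hN h hTinj hα hα1 hT μ hq
    (s := u) (t := t) (by exact_mod_cast huN.le) hut ht
  have hq1 : 0 < q - 1 := by linarith
  have hus : 0 < (u : ℝ) - s := sub_pos.2 (by exact_mod_cast hsu)
  set e : ℝ≥0∞ := ENNReal.ofReal ((1 / 2 : ℝ) ^ (((u : ℝ) - s) * (q - 1))) with he
  have he1 : e < 1 := by
    rw [he, ENNReal.ofReal_lt_one]
    exact Real.rpow_lt_one (by norm_num) (by norm_num) (by positivity)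
  have hM := fun n : ℕ => measurable_momentSum h hα hα1 hT μ q ((1 / 2) ^ n)
  set W : ℕ → ℝ≥0∞ := fun n => ENNReal.ofReal (((1 / 2 : ℝ) ^ n) ^ ((s : ℝ) * (q - 1))) with hW
  have hW0 : ∀ n, W n ≠ 0 := fun n => by
    rw [hW]
    simp only [ne_eq, ENNReal.ofReal_eq_zero, not_le]
    positivity
  have hWtop : ∀ n, W n ≠ ∞ := fun n => by simp [hW]
  have hfin : ∫⁻ x, ∑' n : ℕ, momentSum (projMeasure T μ fun w => ω w x) q ((1 / 2) ^ n) / W n ∂P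
      ≠ ∞ := by
    rw [lintegral_tsum fun n => ((hM n).div_const _).aemeasurable]
    have hterm : ∀ n : ℕ, ∫⁻ x, momentSum (projMeasure T μ fun w => ω w x) q ((1 / 2) ^ n) / W n ∂P
        ≤ A * e ^ n := by
      intro n
      simp only [div_eq_mul_inv]
      rw [lintegral_mul_const _ (by simpa using hM n), ← div_eq_mul_inv,
        ENNReal.div_le_iff (hW0 n) (hWtop n)]
      refine (hbound _ (by positivity)).trans (le_of_eq ?_)
      rw [mul_assoc]
      congr 1
      rw [he, hW, ENNReal.ofReal_rpow_of_pos (by positivity), ← ENNReal.ofReal_pow (by positivity)]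
      simp only
      rw [← ENNReal.ofReal_mul (by positivity)]
      congr 1
      simp only [← Real.rpow_natCast]
      rw [← Real.rpow_mul (by norm_num), ← Real.rpow_mul (by norm_num),
        ← Real.rpow_mul (by norm_num), ← Real.rpow_mul (by norm_num),
        ← Real.rpow_add (by norm_num)]
      congr 1
      ring
    refine ne_top_of_le_ne_top ?_ (ENNReal.tsum_le_tsum hterm)
    rw [ENNReal.tsum_mul_left, ENNReal.tsum_geometric]
    exact ENNReal.mul_ne_top hA (ENNReal.inv_ne_top.2 (tsub_pos_of_lt he1).ne')
  have hmeas : Measurable fun x =>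
      ∑' n : ℕ, momentSum (projMeasure T μ fun w => ω w x) q ((1 / 2) ^ n) / W n :=
    Measurable.tsum fun n => (hM n).div_const _
  filter_upwards [ae_lt_top hmeas hfin] with x hx
  refine le_lowerDim_of_dyadic _ hq s.2 hx.ne fun n => ?_
  rw [← ENNReal.div_le_iff (hW0 n) (hWtop n)]
  exact ENNReal.le_tsum (f := fun n => momentSum (projMeasure T μ fun w => ω w x) q
    ((1 / 2) ^ n) / W n) n

theorem lowerDim_nonneg (τ : Measure (Esp N)) [IsFiniteMeasure τ] {q : ℝ} (hq : 1 < q) :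
    0 ≤ lowerDim τ q := by
  have := le_lowerDim_of_dyadic τ hq le_rfl (A := τ Set.univ ^ q)
    (ENNReal.rpow_ne_top_of_nonneg (by linarith) (measure_ne_top _ _)) fun n => by
      simpa using momentSum_le_rpow τ hq.le (r := (1 / 2) ^ n) (by positivity)
  simpa using this

end LowerBound

/-! ### The upper bound -/

theorem curtail_eq_take {m : ℕ} {w : List (Fin m)} {j : CodeSpace m} (hj : j ∈ wordCylinder w)
    {l : ℕ} (hl : l ≤ w.length) : curtail j l = w.take l := by
  have hw : curtail j w.length = w := hj
  obtain ⟨k, hk⟩ := Nat.exists_eq_add_of_le hl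
  rw [hk, curtail_add] at hw
  rw [← hw, List.take_left' (length_curtail _ _)]

theorem sum_measure_wordCylinder_inter {m : ℕ} (μ : Measure (CodeSpace m)) (A : Set (CodeSpace m))
    (k : ℕ) : ∑ i : Fin k → Fin m, μ (wordCylinder (List.ofFn i) ∩ A) = μ A := by
  induction k with
  | zero => simp [wordCylinder_nil]
  | succ k ih =>
    rw [sum_ofFn_succ fun w => μ (wordCylinder w ∩ A), ← ih]
    exact Finset.sum_congr rfl fun i _ => (measure_wordCylinder_inter μ _ A).symm

section UpperBound

variable {m N : ℕ} {ω : List (Fin m) → Esp N} {R : ℝ} {T : Fin m → Esp N →L[ℝ] Esp N} {α : ℝ}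

/-- The image of a cylinder is contained in an ellipsoid and hence covered by few cubes. -/
theorem exists_measure_cylinder_rpow_le (hα : 0 < α) (hα1 : α < 1) (hT : ∀ i, ‖T i‖ ≤ α)
    (hω : ∀ w, ‖ω w‖ ≤ R) (μ : Measure (CodeSpace m)) {q : ℝ} (hq : 1 ≤ q) :
    ∃ K : ℝ, 0 < K ∧ ∀ (w : List (Fin m)) (r : ℝ), 0 < r →
      μ (wordCylinder w) ^ q ≤ ENNReal.ofReal (K * ∏ i ∈ Finset.range N,
        max 1 ((wordMap T w).toLinearMap.singularValues i / r)) ^ (q - 1) *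
          ∑' l : Fin N → ℤ, μ (wordCylinder w ∩ proj T ω ⁻¹' meshCube r l) ^ q := by
  obtain ⟨K, hK, hcov⟩ := exists_card_meshCube_le N (max 1 (R * (1 - α)⁻¹)) (le_max_left _ _)
  refine ⟨K, hK, fun w r hr => ?_⟩
  obtain ⟨F, hF, hcard⟩ := hcov (wordMap T w) (∑ l ∈ Finset.range w.length,
    wordMap T (w.take l) (ω (w.take (l + 1)))) r hr
  have hsub : wordCylinder w ⊆ ⋃ l ∈ F, proj T ω ⁻¹' meshCube r l := by
    intro j hj
    have h1 : proj T ω j = ∑ l ∈ Finset.range w.length,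
        wordMap T (w.take l) (ω (w.take (l + 1))) +
          wordMap T w (proj T (fun u => ω (w ++ u)) (dropFirst w.length j)) := by
      have hw : curtail j w.length = w := hj
      rw [proj_eq_sum_add hα hα1 hT hω j w.length, hw]
      congr 1
      refine Finset.sum_congr rfl fun l hl => ?_
      have hl' := Finset.mem_range.1 hl
      rw [curtail_eq_take hj hl'.le, curtail_eq_take hj hl']
    have h2 := hF (proj T (fun u => ω (w ++ u)) (dropFirst w.length j))
      ((norm_proj_le hα hα1 hT (fun u => hω _) _).trans (le_max_right _ _))
    rw [← h1] at h2
    simpa using h2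
  refine (measure_rpow_le_of_subset_biUnion μ hq F _ hsub).trans ?_
  have hq1 : 0 ≤ q - 1 := by linarith
  gcongr
  · rw [← ENNReal.ofReal_natCast]
    exact ENNReal.ofReal_le_ofReal hcard
  · simp only [Set.inter_comm _ (wordCylinder w)]
    exact ENNReal.sum_le_tsum (f := fun l => μ (wordCylinder w ∩ proj T ω ⁻¹' meshCube r l) ^ q) F

/-- Apply the covering bound to the empty word: its map is the identity, so for `r < 1` the bounded
support meets at most a constant times `r ^ (-N)` cubes. -/
theorem lowerDim_le_dim (hα : 0 < α) (hα1 : α < 1) (hT : ∀ i, ‖T i‖ ≤ α)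
    (hω : ∀ w, ‖ω w‖ ≤ R) (μ : Measure (CodeSpace m)) [IsFiniteMeasure μ] (hμ : μ ≠ 0) {q : ℝ}
    (hq : 1 < q) : lowerDim (projMeasure T μ ω) q ≤ ((N : ℝ) : EReal) := by
  obtain ⟨K, hK, h⟩ := exists_measure_cylinder_rpow_le hα hα1 hT hω μ hq.le
  have hq1 : 0 < q - 1 := by linarith
  set M : ℝ≥0∞ := μ Set.univ ^ q with hM
  have hMtop : M ≠ ∞ := ENNReal.rpow_ne_top_of_nonneg (by linarith) (measure_ne_top _ _)
  have hM0 : M ≠ 0 := by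
    rw [hM, Ne, ENNReal.rpow_eq_zero_iff_of_pos (by linarith), Measure.measure_univ_eq_zero]
    exact hμ
  have hMpos : 0 < M.toReal := ENNReal.toReal_pos hM0 hMtop
  have hKq : 0 < K ^ (q - 1) := Real.rpow_pos_of_pos hK _
  refine lowerDim_le_of_eventually_le _ hq (c := M.toReal / K ^ (q - 1)) (by positivity) ?_
  have hlt : ∀ᶠ r in 𝓝[>] (0 : ℝ), r ∈ Set.Ioo (0 : ℝ) 1 := Ioo_mem_nhdsGT one_pos
  filter_upwards [hlt] with r hr
  have h1 := h [] r hr.1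
  rw [← momentSum_projMeasure hα hα1 hT μ hω, wordCylinder_nil, ← hM] at h1
  have h2 : ∏ i ∈ Finset.range N,
      max 1 ((wordMap T []).toLinearMap.singularValues i / r) ≤ (1 / r) ^ N := by
    have hconst : (1 / r) ^ N = ∏ _i ∈ Finset.range N, 1 / r := by simp
    rw [hconst]
    refine Finset.prod_le_prod (fun i _ => le_max_of_le_left zero_le_one) fun i _ => ?_
    refine max_le ((one_le_div hr.1).2 hr.2.le) ?_
    have hr0 := hr.1
    gcongr
    exact (singularValues_le_norm _ i).trans (by simpa using norm_wordMap_le hα hT [])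
  have h3 : M ≤ ENNReal.ofReal (K * (1 / r) ^ N) ^ (q - 1) *
      momentSum (projMeasure T μ ω) q r := by
    refine h1.trans ?_
    gcongr
  have hrN : 0 < r ^ ((N : ℝ) * (q - 1)) := Real.rpow_pos_of_pos hr.1 _
  have hr0 := hr.1
  have h4 : ENNReal.ofReal (K * (1 / r) ^ N) ^ (q - 1) =
      ENNReal.ofReal (K ^ (q - 1) / r ^ ((N : ℝ) * (q - 1))) := by
    rw [ENNReal.ofReal_rpow_of_pos (by positivity), Real.mul_rpow hK.le (by positivity),
      one_div, inv_pow, Real.inv_rpow (by positivity), ← Real.rpow_natCast,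
      ← Real.rpow_mul hr.1.le, div_eq_mul_inv]
  have hD : 0 < K ^ (q - 1) / r ^ ((N : ℝ) * (q - 1)) := by positivity
  have h5 : M.toReal / K ^ (q - 1) * r ^ ((N : ℝ) * (q - 1)) =
      M.toReal / (K ^ (q - 1) / r ^ ((N : ℝ) * (q - 1))) := by
    field_simp
  rw [h5, ENNReal.ofReal_div_of_pos hD, ENNReal.ofReal_toReal hMtop]
  rw [h4] at h3
  exact ENNReal.div_le_of_le_mul' h3

/-- The definition of the dimension controls small `r` only; for larger `r` the total mass bounds
the moment sum. -/
theorem exists_momentSum_le (τ : Measure (Esp N)) [IsFiniteMeasure τ] {q t : ℝ} (hq : 1 < q)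
    (ht0 : 0 ≤ t) (ht : (t : EReal) < lowerDim τ q) :
    ∃ A : ℝ≥0∞, A ≠ ∞ ∧ ∀ r : ℝ, 0 < r →
      momentSum τ q r ≤ A * ENNReal.ofReal (r ^ (t * (q - 1))) := by
  have htq : 0 ≤ t * (q - 1) := mul_nonneg ht0 (by linarith)
  obtain ⟨r₀, hr₀, h⟩ := mem_nhdsGT_iff_exists_Ioo_subset.1 (eventually_momentSum_le τ hq ht)
  have hr₀' : (0 : ℝ) < r₀ := hr₀
  have hρ : 0 < r₀ ^ (t * (q - 1)) := Real.rpow_pos_of_pos hr₀' _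
  refine ⟨1 + τ Set.univ ^ q / ENNReal.ofReal (r₀ ^ (t * (q - 1))), ?_, fun r hr => ?_⟩
  · refine ENNReal.add_ne_top.2 ⟨by simp, ENNReal.div_ne_top ?_ (by simpa using hρ)⟩
    exact ENNReal.rpow_ne_top_of_nonneg (by linarith) (measure_ne_top _ _)
  · rcases lt_or_ge r r₀ with hlt | hge
    · have h1 : momentSum τ q r ≤ ENNReal.ofReal (r ^ (t * (q - 1))) := h ⟨hr, hlt⟩
      refine h1.trans (le_mul_of_one_le_left zero_le le_self_add)
    · calc momentSum τ q r ≤ τ Set.univ ^ q := momentSum_le_rpow τ hq.le hr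
        _ = τ Set.univ ^ q / ENNReal.ofReal (r₀ ^ (t * (q - 1))) *
              ENNReal.ofReal (r₀ ^ (t * (q - 1))) :=
            (ENNReal.div_mul_cancel (by simpa using hρ) (by simp)).symm
        _ ≤ _ := by
            gcongr
            exact le_add_self

/-- Deterministic: each word is tested at the dyadic scale of its own critical singular value, where
the covering number matches `φ^s r^(-s)`. The strict gap to the dimension makes the sums over scales
and lengths converge. -/
theorem momentSeries_lt_top (hN : 0 < N) (hTinj : ∀ i, Function.Injective (T i))
    (hα : 0 < α) (hα1 : α < 1) (hT : ∀ i, ‖T i‖ ≤ α)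
    (hω : ∀ w, ‖ω w‖ ≤ R) (μ : Measure (CodeSpace m)) [IsFiniteMeasure μ] {q : ℝ}
    (hq : 1 < q) {s : ℝ≥0} (hs : (s : ℝ) ≤ N)
    (h : ((s : ℝ) : EReal) < lowerDim (projMeasure T μ ω) q) : momentSeries T μ q s < ∞ := by
  obtain ⟨t, hst, ht⟩ := EReal.lt_iff_exists_real_btwn.1 h
  have hst : (s : ℝ) < t := by exact_mod_cast hst
  have hq1 : 0 < q - 1 := by linarith
  have : IsFiniteMeasure (projMeasure T μ ω) := by unfold projMeasure; infer_instance
  obtain ⟨A, hA, hM⟩ := exists_momentSum_le _ hq (s.2.trans hst.le) ht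
  obtain ⟨K, hK, hcyl⟩ := exists_measure_cylinder_rpow_le hα hα1 hT hω μ hq.le
  set Y : List (Fin m) → ℕ → ℝ≥0∞ := fun w n =>
    ∑' l : Fin N → ℤ, μ (wordCylinder w ∩ proj T ω ⁻¹' meshCube ((1 / 2) ^ n) l) ^ q with hY
  set W : ℕ → ℝ≥0∞ := fun n => ENNReal.ofReal (((1 / 2 : ℝ) ^ n) ^ (-((s : ℝ) * (q - 1)))) with hW
  set B : ℝ≥0∞ := ENNReal.ofReal (K * 2 ^ N) ^ (q - 1) with hB
  have hBtop : B ≠ ∞ := ENNReal.rpow_ne_top_of_nonneg hq1.le (by simp)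
  set φ : List (Fin m) → ℝ := fun w => singularValueFunction s (wordMap T w) with hφ
  have hword : ∀ w : List (Fin m), ∃ n : ℕ, (1 / 2 : ℝ) ^ n ≤ 2 * α ^ w.length ∧
      ENNReal.ofReal (φ w) ^ (1 - q) * μ (wordCylinder w) ^ q ≤ B * W n * Y w n := by
    intro w
    have hinj := wordMap_injective hTinj w
    have hφpos : 0 < φ w := singularValueFunction_pos hN s hinj
    set a := (wordMap T w).toLinearMap.singularValues (⌈s⌉₊ - 1) with ha
    have hceil : ⌈s⌉₊ ≤ N := Nat.ceil_le.2 (by exact_mod_cast hs)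
    have ha0 : 0 < a := singularValues_pos hinj (by omega)
    have haα : a ≤ α ^ w.length := (singularValues_le_norm _ _).trans (norm_wordMap_le hα hT w)
    have ha1 : a ≤ 1 := haα.trans (pow_le_one₀ hα.le hα1.le)
    obtain ⟨n, hn1, hn2⟩ := exists_nat_pow_near_of_lt_one ha0 ha1
      (by norm_num : (0 : ℝ) < 1 / 2) (by norm_num)
    have hn3 : (1 / 2 : ℝ) ^ n ≤ 2 * a := by
      rw [pow_succ] at hn1
      linarith
    refine ⟨n, hn3.trans (by linarith), ?_⟩
    have hr : (0 : ℝ) < (1 / 2) ^ n := by positivity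
    have h1 := hcyl w _ hr
    have h2 := prod_max_le hN hs hinj hr hn2 hn3
    have hrs : 0 < ((1 / 2 : ℝ) ^ n) ^ (s : ℝ) := Real.rpow_pos_of_pos hr _
    have hWn : W n = ENNReal.ofReal ((((1 / 2 : ℝ) ^ n) ^ (s : ℝ))⁻¹) ^ (q - 1) := by
      rw [ENNReal.ofReal_rpow_of_pos (by positivity), Real.inv_rpow hrs.le,
        ← Real.rpow_mul hr.le, ← Real.rpow_neg hr.le]
    have h3 : μ (wordCylinder w) ^ q ≤
        B * W n * ENNReal.ofReal (φ w) ^ (q - 1) * Y w n := by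
      refine h1.trans ?_
      gcongr
      rw [hB, hWn, ← ENNReal.mul_rpow_of_nonneg _ _ hq1.le, ← ENNReal.mul_rpow_of_nonneg _ _ hq1.le,
        ← ENNReal.ofReal_mul (by positivity), ← ENNReal.ofReal_mul (by positivity)]
      refine ENNReal.rpow_le_rpow (ENNReal.ofReal_le_ofReal ?_) hq1.le
      calc K * ∏ i ∈ Finset.range N,
            max 1 ((wordMap T w).toLinearMap.singularValues i / (1 / 2) ^ n)
          ≤ K * (2 ^ N * (φ w / ((1 / 2 : ℝ) ^ n) ^ (s : ℝ))) := by gcongr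
        _ = _ := by rw [div_eq_mul_inv]; ring
    calc ENNReal.ofReal (φ w) ^ (1 - q) * μ (wordCylinder w) ^ q
        ≤ ENNReal.ofReal (φ w) ^ (1 - q) *
            (B * W n * ENNReal.ofReal (φ w) ^ (q - 1) * Y w n) := by gcongr
      _ = (ENNReal.ofReal (φ w) ^ (1 - q) * ENNReal.ofReal (φ w) ^ (q - 1)) *
            (B * W n * Y w n) := by ring
      _ = B * W n * Y w n := by
          rw [← ENNReal.rpow_add _ _ (by simpa using hφpos) (by simp)]
          simp
  -- Words of a fixed length partition the code space, so within each cube their contributions are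
  -- superadditive for `q ≥ 1`.
  have hsumY : ∀ k n, ∑ i : Fin k → Fin m, Y (List.ofFn i) n ≤
      A * ENNReal.ofReal (((1 / 2 : ℝ) ^ n) ^ (t * (q - 1))) := by
    intro k n
    refine le_trans ?_ (hM _ (by positivity))
    rw [momentSum_projMeasure hα hα1 hT μ hω, hY,
      ← Summable.tsum_finsetSum fun i _ => ENNReal.summable]
    refine ENNReal.tsum_le_tsum fun l => ?_
    have h1 := tsum_rpow_le_rpow_tsum (fun i : Fin k → Fin m =>
      μ (wordCylinder (List.ofFn i) ∩ proj T ω ⁻¹' meshCube ((1 / 2) ^ n) l)) hq.le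
    rw [tsum_fintype, tsum_fintype, sum_measure_wordCylinder_inter] at h1
    rwa [wordCylinder_nil, Set.univ_inter]
  -- Half of the spare exponent gives decay in the word length, through `(1 / 2) ^ n ≤ 2 * α ^ k`;
  -- the other half gives decay in the scale index `n`.
  set ε : ℝ := (t - s) * (q - 1) / 2 with hε
  have hεpos : 0 < ε := by
    have : 0 < t - s := by linarith
    positivity
  set e : ℝ≥0∞ := ENNReal.ofReal ((1 / 2 : ℝ) ^ ε) with he
  have he1 : e < 1 := by
    rw [he, ENNReal.ofReal_lt_one]
    exact Real.rpow_lt_one (by norm_num) (by norm_num) hεpos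
  set d : ℝ≥0∞ := ENNReal.ofReal (α ^ ε) with hd
  have hd1 : d < 1 := by
    rw [hd, ENNReal.ofReal_lt_one]
    exact Real.rpow_lt_one hα.le hα1 hεpos
  have hgeom : ∀ k n : ℕ, (1 / 2 : ℝ) ^ n ≤ 2 * α ^ k →
      W n * ENNReal.ofReal (((1 / 2 : ℝ) ^ n) ^ (t * (q - 1))) ≤
        ENNReal.ofReal (2 ^ ε) * d ^ k * e ^ n := by
    intro k n hkn
    have hr : (0 : ℝ) < (1 / 2) ^ n := by positivity
    rw [hW, hd, he, ← ENNReal.ofReal_pow (by positivity), ← ENNReal.ofReal_pow (by positivity)]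
    simp only
    rw [← ENNReal.ofReal_mul (by positivity), ← ENNReal.ofReal_mul (by positivity),
      ← ENNReal.ofReal_mul (by positivity)]
    refine ENNReal.ofReal_le_ofReal ?_
    calc ((1 / 2 : ℝ) ^ n) ^ (-((s : ℝ) * (q - 1))) * ((1 / 2 : ℝ) ^ n) ^ (t * (q - 1))
        = ((1 / 2 : ℝ) ^ n) ^ ε * ((1 / 2 : ℝ) ^ n) ^ ε := by
          rw [← Real.rpow_add hr, ← Real.rpow_add hr]
          congr 1
          rw [hε]
          ring
      _ ≤ (2 * α ^ k) ^ ε * ((1 / 2 : ℝ) ^ n) ^ ε := by gcongr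
      _ = _ := by
          rw [Real.mul_rpow (by norm_num) (by positivity)]
          simp only [← Real.rpow_natCast]
          rw [← Real.rpow_mul hα.le, ← Real.rpow_mul hα.le, ← Real.rpow_mul (by norm_num),
            ← Real.rpow_mul (by norm_num), mul_comm (k : ℝ), mul_comm (n : ℝ)]
  have hlevel : ∀ k, ∑ i : Fin k → Fin m,
      ENNReal.ofReal (φ (List.ofFn i)) ^ (1 - q) * μ (wordCylinder (List.ofFn i)) ^ q ≤
        B * A * ENNReal.ofReal (2 ^ ε) * (1 - e)⁻¹ * d ^ k := by
    intro k
    classical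
    calc ∑ i : Fin k → Fin m,
          ENNReal.ofReal (φ (List.ofFn i)) ^ (1 - q) * μ (wordCylinder (List.ofFn i)) ^ q
        -- The scale depends on the word, so it is replaced by the sum over all admissible scales;
        -- the two sums can then be interchanged.
        ≤ ∑ i : Fin k → Fin m, ∑' n : ℕ,
            if (1 / 2 : ℝ) ^ n ≤ 2 * α ^ k then B * W n * Y (List.ofFn i) n else 0 := by
          refine Finset.sum_le_sum fun i _ => ?_
          obtain ⟨n, hn1, hn2⟩ := hword (List.ofFn i)
          rw [List.length_ofFn] at hn1
          refine le_trans ?_ (ENNReal.le_tsum n)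
          rwa [if_pos hn1]
      _ = ∑' n : ℕ, ∑ i : Fin k → Fin m,
            if (1 / 2 : ℝ) ^ n ≤ 2 * α ^ k then B * W n * Y (List.ofFn i) n else 0 :=
          (Summable.tsum_finsetSum fun i _ => ENNReal.summable).symm
      _ ≤ ∑' n : ℕ, B * A * ENNReal.ofReal (2 ^ ε) * d ^ k * e ^ n := by
          refine ENNReal.tsum_le_tsum fun n => ?_
          split_ifs with hkn
          · rw [← Finset.mul_sum]
            calc B * W n * ∑ i : Fin k → Fin m, Y (List.ofFn i) n
                ≤ B * W n * (A * ENNReal.ofReal (((1 / 2 : ℝ) ^ n) ^ (t * (q - 1)))) := by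
                  gcongr
                  exact hsumY k n
              _ = B * A * (W n * ENNReal.ofReal (((1 / 2 : ℝ) ^ n) ^ (t * (q - 1)))) := by ring
              _ ≤ B * A * (ENNReal.ofReal (2 ^ ε) * d ^ k * e ^ n) :=
                  mul_le_mul_right (hgeom k n hkn) _
              _ = _ := by ring
          · simp
      _ = _ := by
          rw [ENNReal.tsum_mul_left, ENNReal.tsum_geometric]
          ring
  refine (ENNReal.tsum_le_tsum hlevel).trans_lt ?_
  rw [ENNReal.tsum_mul_left, ENNReal.tsum_geometric]
  refine ENNReal.mul_lt_top (ENNReal.mul_lt_top (ENNReal.mul_lt_top (ENNReal.mul_lt_top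
    hBtop.lt_top hA.lt_top) (by simp)) ?_) ?_
  · exact (ENNReal.inv_ne_top.2 (tsub_pos_of_lt he1).ne').lt_top
  · exact (ENNReal.inv_ne_top.2 (tsub_pos_of_lt hd1).ne').lt_top

theorem lowerDim_le_min (hN : 0 < N) (hTinj : ∀ i, Function.Injective (T i))
    (hα : 0 < α) (hα1 : α < 1) (hT : ∀ i, ‖T i‖ ≤ α)
    (hω : ∀ w, ‖ω w‖ ≤ R) (μ : Measure (CodeSpace m)) [IsFiniteMeasure μ] (hμ : μ ≠ 0) {q : ℝ}
    (hq : 1 < q) :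
    lowerDim (projMeasure T μ ω) q ≤ ((min (dqLower T μ q) (N : ℝ≥0∞) : ℝ≥0∞) : EReal) := by
  by_contra hcon
  push Not at hcon
  obtain ⟨p, hp1, hp2⟩ := EReal.lt_iff_exists_real_btwn.1 hcon
  have hp0 : 0 ≤ p := by
    have : (0 : EReal) ≤ p := (EReal.coe_ennreal_nonneg _).trans hp1.le
    exact_mod_cast this
  lift p to ℝ≥0 using hp0
  have hpN : (p : ℝ) ≤ N := by
    have := hp2.le.trans (lowerDim_le_dim hα hα1 hT hω μ hμ hq)
    exact_mod_cast this
  have hmin : min (dqLower T μ q) (N : ℝ≥0∞) < p := by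
    rw [← EReal.coe_ennreal_lt_coe_ennreal_iff]
    exact hp1
  have hd : dqLower T μ q < p := by
    rcases min_lt_iff.1 hmin with h | h
    · exact h
    · have h' : (N : ℝ≥0) < p := by exact_mod_cast h
      have h'' : p ≤ (N : ℝ≥0) := by exact_mod_cast hpN
      exact absurd h' (not_lt.2 h'')
  have hlt := momentSeries_lt_top hN hTinj hα hα1 hT hω μ hq hpN hp2
  exact absurd hd (not_lt.2 (le_iSup₂ (f := fun (s : ℝ≥0) (_ : momentSeries T μ q s < ∞) =>
    (s : ℝ≥0∞)) p hlt))

end UpperBound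

/-! ### The generic formula -/

theorem ae_lowerDim_eq {m N : ℕ} (hN : 0 < N) {T : Fin m → Esp N →L[ℝ] Esp N}
    (hTinj : ∀ i, Function.Injective (T i)) (hTnorm : ∀ i, ‖T i‖ < 1)
    (μ : Measure (CodeSpace m)) [IsFiniteMeasure μ] (hμ : μ ≠ 0)
    {Ω : Type*} [MeasurableSpace Ω] {P : Measure Ω} [IsProbabilityMeasure P]
    {ω : List (Fin m) → Ω → Esp N} {R : ℝ} (h : IsBoundedIID P ω R) {q : ℝ} (hq : 1 < q) :
    ∀ᵐ x ∂P, lowerDim (projMeasure T μ fun w => ω w x) q =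
      ((min (dqLower T μ q) (N : ℝ≥0∞) : ℝ≥0∞) : EReal) := by
  obtain ⟨α, hα, hα1, hT⟩ := exists_norm_le T hTnorm
  -- Countably many thresholds keep a common null set. Negative rationals become `0` under
  -- `toNNReal`, which does no harm.
  have hae : ∀ᵐ x ∂P, ∀ p : ℚ, ((p : ℝ).toNNReal : ℝ≥0∞) < min (dqLower T μ q) N →
      (((p : ℝ).toNNReal : ℝ) : EReal) ≤ lowerDim (projMeasure T μ fun w => ω w x) q := by
    rw [ae_all_iff]
    intro p
    by_cases hp : ((p : ℝ).toNNReal : ℝ≥0∞) < min (dqLower T μ q) N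
    · filter_upwards [ae_le_lowerDim hN h hTinj hα hα1 hT μ hq hp] with x hx _ using hx
    · exact Eventually.of_forall fun x hx => absurd hx hp
  filter_upwards [hae] with x hx
  refine le_antisymm
    (lowerDim_le_min hN hTinj hα hα1 hT (fun w => h.bound w x) μ hμ hq) ?_
  by_contra hcon
  push Not at hcon
  obtain ⟨p, hp1, hp2⟩ := EReal.lt_iff_exists_rat_btwn.1 hcon
  have : IsFiniteMeasure (projMeasure T μ fun w => ω w x) := by unfold projMeasure; infer_instance
  have hp0 : (0 : ℝ) ≤ p := by
    have : (0 : EReal) ≤ ((p : ℝ) : EReal) := (lowerDim_nonneg _ hq).trans hp1.le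
    exact_mod_cast this
  have hpe : (((p : ℝ).toNNReal : ℝ) : EReal) = ((p : ℝ) : EReal) := by
    rw [Real.coe_toNNReal _ hp0]
  have hlt : ((p : ℝ).toNNReal : ℝ≥0∞) < min (dqLower T μ q) N := by
    rw [← EReal.coe_ennreal_lt_coe_ennreal_iff]
    exact hpe.trans_lt hp2
  have := hx p hlt
  rw [hpe] at this
  exact absurd hp1 (not_lt.2 this)

/-- Displacements that are almost surely bounded may be truncated. -/
theorem isBoundedIID_indicator {m N : ℕ} {Ω : Type*} [MeasurableSpace Ω] {P : Measure Ω}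
    {ω : List (Fin m) → Ω → Esp N} (hmeas : ∀ w, Measurable (ω w)) (hindep : iIndepFun ω P)
    (hident : ∀ v w, IdentDistrib (ω v) (ω w) P P) (hac : ∀ w, P.map (ω w) ≪ volume) {R : ℝ}
    (hR : 0 ≤ R) (hbound : ∀ w, ∀ᵐ x ∂P, ‖ω w x‖ ≤ R) :
    IsBoundedIID P (fun w x => (Metric.closedBall (0 : Esp N) R).indicator id (ω w x)) R := by
  have hf : Measurable ((Metric.closedBall (0 : Esp N) R).indicator id) :=
    measurable_id.indicator Metric.isClosed_closedBall.measurableSet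
  refine ⟨fun w => hf.comp (hmeas w), hindep.comp (fun _ => _) (fun _ => hf),
    fun v w => (hident v w).comp hf, fun w => ?_, fun w x => ?_⟩
  · rw [Measure.map_congr (g := ω w)]
    · exact hac w
    · filter_upwards [hbound w] with x hx
      exact Set.indicator_of_mem (mem_closedBall_zero_iff.2 hx) _
  · by_cases hx : ω w x ∈ Metric.closedBall (0 : Esp N) R
    · rw [Set.indicator_of_mem hx]
      exact mem_closedBall_zero_iff.1 hx
    · rw [Set.indicator_of_notMem hx]
      simpa using hR

end AlmostSelfAffine

end

theorem theorem8p1 {m N : ℕ} (hN : 0 < N)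
    (T : Fin m → AlmostSelfAffine.Esp N →L[ℝ] AlmostSelfAffine.Esp N)
    (hT_inj : ∀ i, Function.Injective (T i)) (hT_norm : ∀ i, ‖T i‖ < 1)
    (μ : Measure (AlmostSelfAffine.CodeSpace m)) [IsFiniteMeasure μ] (hμ : μ ≠ 0)
    {Ω : Type*} [MeasurableSpace Ω] (P : Measure Ω) [IsProbabilityMeasure P]
    (ω : List (Fin m) → Ω → AlmostSelfAffine.Esp N)
    (hω_meas : ∀ w, Measurable (ω w))
    (hω_indep : iIndepFun ω P)
    (hω_ident : ∀ v w, IdentDistrib (ω v) (ω w) P P)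
    (hω_ac : ∀ w, P.map (ω w) ≪ volume)
    (D : Set (AlmostSelfAffine.Esp N)) (hD : Bornology.IsBounded D)
    (hω_mem : ∀ w, ∀ᵐ x ∂P, ω w x ∈ D)
    (q : ℝ) (hq : 1 < q) :
    ∀ᵐ x ∂P,
      AlmostSelfAffine.lowerDim (AlmostSelfAffine.projMeasure T μ fun w => ω w x) q =
        ((min (AlmostSelfAffine.dqLower T μ q) (N : ℝ≥0∞) : ℝ≥0∞) : EReal) := by
  obtain ⟨R, hR, hDR⟩ := hD.exists_pos_norm_le
  have hbound : ∀ w, ∀ᵐ x ∂P, ‖ω w x‖ ≤ R := fun w => (hω_mem w).mono fun x hx => hDR _ hx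
  have h := AlmostSelfAffine.isBoundedIID_indicator hω_meas hω_indep hω_ident hω_ac hR.le hbound
  filter_upwards [AlmostSelfAffine.ae_lowerDim_eq hN hT_inj hT_norm μ hμ h hq,
    ae_all_iff.2 hbound] with x hx hx'
  -- There are countably many words, so almost surely truncation changes no displacement at all.
  have heq : (fun w => (Metric.closedBall (0 : AlmostSelfAffine.Esp N) R).indicator id (ω w x)) =
      fun w => ω w x :=
    funext fun w => Set.indicator_of_mem (mem_closedBall_zero_iff.2 (hx' w)) _
  rwa [heq] at hx
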